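/- Let $\rho,\sigma>0$ be (invertible) density matrices on a $d$-dimensional quantum system. A POVM is a finite family $M=(M(y))_y$ of positive semidefinite $d\times d$ matrices with $\sum_y M(y)=I$; write $P^M_\rho(y)=\operatorname{Tr}M(y)\rho$ for its outcome distribution in the state $\rho$. For distributions $P,Q$ let $D(P\|Q)=\sum_y P(y)\log\frac{P(y)}{Q(y)}$ and $\phi(s|P\|Q)=\log\sum_{y:P(y)>0}P(y)^{1-s}Q(y)^{s}$. An adaptive (one-way LOCC) test on $n$ copies chooses, for $k=1,\dots,n$, the $k$-th POVM $M_k$ at random from a distribution that may depend (measurably) on $(M_1,y_1),\dots,(M_{k-1},y_{k-1})$, applies it to the $k$-th copy to obtain the outcome $y_k$, and finally accepts the alternative hypothesis with probability $f_n(M_1,y_1,\dots,M_n,y_n)$, where $f_n$ is a measurable $[0,1]$-valued function. Let $\mathrm E_{\rho,n}$ and $\mathrm E_{\sigma,n}$ denote the expectations over the data when the copies are in the state $\rho^{\otimes n}$ (null hypothesis) and $\sigma^{\otimes n}$ (alternative hypothesis). With $-\log 0=+\infty$ put, the suprema and infima being over sequences of such tests, \begin{align*} B&=\sup\Bigl\{\varliminf_n\tfrac{-\log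 \mathrm E_{\sigma,n}(1-f_n)}{n}\Bigm|\lim_n \mathrm E_{\rho,n}f_n=0\Bigr\},\\ B^*&=\sup\Bigl\{\varliminf_n\tfrac{-\log \mathrm E_{\sigma,n}(1-f_n)}{n}\Bigm|\varliminf_n \mathrm E_{\rho,n}f_n<1\Bigr\},\\ B_e(r)&=\sup\Bigl\{\varliminf_n\tfrac{-\log \mathrm E_{\rho,n}f_n}{n}\Bigm|\varliminf_n\tfrac{-\log \mathrm E_{\sigma,n}(1-f_n)}{n}\ge r\Bigr\},\\ B_e^*(r)&=\inf\Bigl\{\varliminf_n\tfrac{-\log \mathrm E_{\rho,n}(1-f_n)}{n}\Bigm|\varliminf_n\tfrac{-\log \mathrm E_{\sigma,n}(1-f_n)}{n}\ge r\Bigr\},\\ C&=\lim_n\tfrac{-1}{n}\log\inf\bigl(\mathrm E_{\rho,n}f_n+\mathrm E_{\sigma,n}(1-f_n)\bigr). \end{align*} Then the limit $C$ exists, the maxima over POVMs below are attained, and \begin{align*} B=B^*&=\max_{M}D(P^M_\rho\|P^M_\sigma),\\ C&=\max_M\Bigl(-\min_{0\le s\le1}\phi(s|P^M_\rho\|P^M_\sigma)\Bigr),\\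 B_e(r)&=\max_M\sup_{0\le s<1}\frac{-sr-\phi(s|P^M_\rho\|P^M_\sigma)}{1-s}\qquad(r>0),\\ B_e^*(r)&=\sup_{s\le0}\frac{-sr-\max_M\phi(s|P^M_\rho\|P^M_\sigma)}{1-s}\qquad(r\in\mathbb R). \end{align*} Moreover, one-way communication gives no improvement: $B$, $B^*$, $C$ and $B_e(r)$ ($r>0$) keep their values if only tests are allowed that apply one and the same POVM to all $n$ copies, and $B_e^*(r)$ keeps its value if only tests are allowed that draw the POVMs $M_1,\dots,M_n$ independently from one distribution supported on at most two POVMs. -/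

import Mathlib

open MeasureTheory ProbabilityTheory Filter Topology
open scoped ENNReal ComplexOrder

noncomputable section

namespace OneWayLOCC

/-- A state (density matrix) of a `d`-dimensional quantum system. -/
structure State (d : ℕ) where
  mat : Matrix (Fin d) (Fin d) ℂ
  posSemidef : mat.PosSemidef
  trace_eq_one : mat.trace = 1

/-- A POVM on a `d`-dimensional system with finitely many outcomes (of any number). The outcomes
are labelled by natural numbers; all but finitely many labels carry the effect `0`. -/
structure POVM (d : ℕ) where
  effect : ℕ →₀ Matrix (Fin d) (Fin d) ℂ
  posSemidef : ∀ y, (effect y).PosSemidef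
  sum_eq_one : (effect.sum fun _ A => A) = 1

/-- The σ-algebra generated by the matrix entries of the effects. -/
instance (d : ℕ) : MeasurableSpace (POVM d) :=
  MeasurableSpace.comap (fun (M : POVM d) (y : ℕ) (i j : Fin d) => M.effect y i j) inferInstance

open scoped MatrixOrder in
theorem trace_mul_nonneg {d : ℕ} {A B : Matrix (Fin d) (Fin d) ℂ} (hA : A.PosSemidef)
    (hB : B.PosSemidef) : 0 ≤ (A * B).trace := by
  obtain ⟨C, rfl⟩ := CStarAlgebra.nonneg_iff_eq_star_mul_self.1 hB.nonneg
  rw [← Matrix.mul_assoc, Matrix.trace_mul_comm, ← Matrix.mul_assoc]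
  exact (hA.mul_mul_conjTranspose_same C).trace_nonneg

theorem tsum_outcome {d : ℕ} (M : POVM d) (ρ : State d) :
    ∑' y, ENNReal.ofReal (M.effect y * ρ.mat).trace.re = 1 := by
  rw [tsum_eq_sum (s := M.effect.support)
    (fun y hy => by simp [Finsupp.notMem_support_iff.1 hy]),
    ← ENNReal.ofReal_sum_of_nonneg
      (fun y _ => (Complex.le_def.1 (trace_mul_nonneg (M.posSemidef y) ρ.posSemidef)).1),
    ← Complex.re_sum, ← Matrix.trace_sum, ← Finset.sum_mul]
  have h : ∑ y ∈ M.effect.support, M.effect y = 1 := M.sum_eq_one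
  rw [h, one_mul, ρ.trace_eq_one]
  simp

/-- The distribution `P^M_ρ` of the outcome of the measurement `M` in the state `ρ`:
`P^M_ρ(y) = Tr M(y) ρ`. -/
def outcome {d : ℕ} (ρ : State d) (M : POVM d) : PMF ℕ :=
  ⟨fun y => ENNReal.ofReal (M.effect y * ρ.mat).trace.re,
    tsum_outcome M ρ ▸ ENNReal.summable.hasSum⟩

theorem measurable_outcome {d : ℕ} (ρ : State d) (y : ℕ) :
    Measurable fun M : POVM d => outcome ρ M y := by
  have h : ∀ i j : Fin d, Measurable fun M : POVM d => M.effect y i j := fun i j => by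
    have h0 : Measurable fun g : ℕ → Fin d → Fin d → ℂ => g y i j := by fun_prop
    exact h0.comp (comap_measurable fun (M : POVM d) (y : ℕ) (i j : Fin d) => M.effect y i j)
  change Measurable fun M : POVM d => ENNReal.ofReal (M.effect y * ρ.mat).trace.re
  simp only [Matrix.trace, Matrix.diag, Matrix.mul_apply]
  refine ENNReal.measurable_ofReal.comp (Complex.measurable_re.comp ?_)
  exact Finset.measurable_sum _ fun i _ => Finset.measurable_sum _ fun j _ =>
    (h i j).mul_const _

/-- The classical channel `M ↦ P^M_ρ` from POVMs to outcomes. -/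
def channel {d : ℕ} (ρ : State d) : Kernel (POVM d) ℕ where
  toFun M := (outcome ρ M).toMeasure
  measurable' := by
    refine Measure.measurable_of_measurable_coe _ fun s hs => ?_
    simp only [PMF.toMeasure_apply _ hs]
    refine Measurable.tsum fun y => ?_
    by_cases hy : y ∈ s
    · simpa [Set.indicator, hy] using measurable_outcome ρ y
    · simp [Set.indicator, hy]

instance {d : ℕ} (ρ : State d) : IsMarkovKernel (channel ρ) :=
  ⟨fun M => inferInstanceAs (IsProbabilityMeasure (outcome ρ M).toMeasure)⟩

/-- The data after `n` measurements: the pairs (POVM, outcome) of all steps. -/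
abbrev Hist (d n : ℕ) : Type := Fin n → POVM d × ℕ

/-- A one-way adaptive measurement strategy: the `k`-th POVM is drawn from a distribution that may
depend on all preceding POVMs and outcomes. -/
structure Strategy (d : ℕ) where
  input : ∀ k : ℕ, Kernel (Hist d k) (POVM d)
  markov : ∀ k, IsMarkovKernel (input k)

/-- The joint law of the data of the first `n` steps of the strategy, applied to the `n` copies
`ρ^{⊗ n}`. -/
def Strategy.law {d : ℕ} (S : Strategy d) (ρ : State d) : ∀ n : ℕ, Measure (Hist d n)
  | 0 => Measure.dirac Fin.elim0
  | n + 1 => ((S.law ρ n) ⊗ₘ (S.input n ⊗ₖ Kernel.prodMkLeft (Hist d n) (channel ρ))).map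
      fun p => (Fin.snoc p.1 p.2 : Hist d (n + 1))

/-- All one-way adaptive strategies. -/
def adaptive (d : ℕ) : Set (Strategy d) := Set.univ

/-- Deterministic non-adaptive strategies: one fixed POVM is applied to every copy. -/
def detNonadaptive (d : ℕ) : Set (Strategy d) :=
  {S | ∃ M : POVM d, ∀ k, S.input k = Kernel.const _ (Measure.dirac M)}

/-- Stochastic non-adaptive strategies with two POVMs: the POVM of each copy is drawn independently
from one fixed distribution that charges at most two POVMs. -/
def twoPointNonadaptive (d : ℕ) : Set (Strategy d) :=
  {S | ∃ (M M' : POVM d) (t : ℝ≥0∞), t ≤ 1 ∧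
    ∀ k, S.input k = Kernel.const _ (t • Measure.dirac M + (1 - t) • Measure.dirac M')}

/-- A randomized test on `n` copies: a strategy and a `[0,1]`-valued function `f` of the data, the
probability of deciding for the alternative hypothesis. -/
structure Test (d n : ℕ) where
  strategy : Strategy d
  f : Hist d n → ℝ≥0∞
  measurable_f : Measurable f
  f_le_one : ∀ h, f h ≤ 1

/-- `E f`: the probability of deciding for the alternative when the state is `ρ^{⊗ n}`. -/
def Test.acceptAlt {d n : ℕ} (T : Test d n) (ρ : State d) : ℝ≥0∞ :=
  ∫⁻ h, T.f h ∂(T.strategy.law ρ n)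

/-- `E (1 - f)`: the probability of deciding for the null hypothesis when the state is
`ρ^{⊗ n}`. -/
def Test.acceptNull {d n : ℕ} (T : Test d n) (ρ : State d) : ℝ≥0∞ :=
  ∫⁻ h, (1 - T.f h) ∂(T.strategy.law ρ n)

/-- `-(1/n) log p`, with the value `⊤` at `p = 0`. -/
def rate (n : ℕ) (p : ℝ≥0∞) : EReal := -(ENNReal.log p) / (n : EReal)

/-- A sequence of tests, the `n`-th one on `n` copies, with strategies from the class `𝒞`. -/
def IsTestSeq {d : ℕ} (𝒞 : Set (Strategy d)) (T : ∀ n, Test d n) : Prop :=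
  ∀ n, (T n).strategy ∈ 𝒞

/-- Stein exponent `B`: the null hypothesis is `ρ`, the alternative is `σ`. -/
def stein {d : ℕ} (𝒞 : Set (Strategy d)) (ρ σ : State d) : EReal :=
  sSup {e | ∃ T : ∀ n, Test d n, IsTestSeq 𝒞 T ∧
    Tendsto (fun n => (T n).acceptAlt ρ) atTop (𝓝 0) ∧
    e = liminf (fun n => rate n ((T n).acceptNull σ)) atTop}

/-- Strong converse Stein exponent `B^*`. -/
def steinStrong {d : ℕ} (𝒞 : Set (Strategy d)) (ρ σ : State d) : EReal :=
  sSup {e | ∃ T : ∀ n, Test d n, IsTestSeq 𝒞 T ∧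
    liminf (fun n => (T n).acceptAlt ρ) atTop < 1 ∧
    e = liminf (fun n => rate n ((T n).acceptNull σ)) atTop}

/-- Hoeffding exponent `B_e(r)`. -/
def hoeffding {d : ℕ} (𝒞 : Set (Strategy d)) (r : ℝ) (ρ σ : State d) : EReal :=
  sSup {e | ∃ T : ∀ n, Test d n, IsTestSeq 𝒞 T ∧
    (r : EReal) ≤ liminf (fun n => rate n ((T n).acceptNull σ)) atTop ∧
    e = liminf (fun n => rate n ((T n).acceptAlt ρ)) atTop}

/-- Han–Kobayashi exponent `B_e^*(r)`. -/
def hanKobayashi {d : ℕ} (𝒞 : Set (Strategy d)) (r : ℝ) (ρ σ : State d) : EReal :=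
  sInf {e | ∃ T : ∀ n, Test d n, IsTestSeq 𝒞 T ∧
    (r : EReal) ≤ liminf (fun n => rate n ((T n).acceptNull σ)) atTop ∧
    e = liminf (fun n => rate n ((T n).acceptNull ρ)) atTop}

/-- The least sum of the two error probabilities with `n` copies. -/
def minErrorSum {d : ℕ} (𝒞 : Set (Strategy d)) (ρ σ : State d) (n : ℕ) : ℝ≥0∞ :=
  ⨅ T ∈ {T : Test d n | T.strategy ∈ 𝒞}, T.acceptAlt ρ + T.acceptNull σ

/-- `φ(s|P‖Q) = log ∑_y P(y) (Q(y)/P(y))^s`, the sum being over the support of `P`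
(in `ℝ≥0∞`, the terms with `P y = 0` vanish). -/
def phi (s : ℝ) (P Q : PMF ℕ) : EReal :=
  ENNReal.log (∑' y, P y * (Q y / P y) ^ s)

/-- The relative entropy `D(P^M_ρ‖P^M_σ)`. -/
def measuredKL {d : ℕ} (ρ σ : State d) (M : POVM d) : EReal :=
  ((InformationTheory.klDiv (outcome ρ M).toMeasure (outcome σ M).toMeasure : ℝ≥0∞) : EReal)

/-- `φ(s|P^M_ρ‖P^M_σ)`. -/
def measuredPhi {d : ℕ} (s : ℝ) (ρ σ : State d) (M : POVM d) : EReal :=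
  phi s (outcome ρ M) (outcome σ M)

/-- `(-s r - a) / (1 - s)`. -/
def tilt (r s : ℝ) (a : EReal) : EReal := (((-s * r : ℝ) : EReal) - a) / ((1 - s : ℝ) : EReal)

end OneWayLOCC

end

noncomputable section

namespace OneWayLOCC

/-! Positive definiteness makes the log-likelihood ratio of every effect bounded by one constant
`L`, whatever the POVM (`exists_comparable`, `Comparable.abs_logRatio_le`). The mechanism that draws
the POVMs is the same under both states, so it cancels from the likelihood ratio: the law of the
data under `σ` has density `weight (llr ρ σ)` with respect to the law under `ρ`
(`Comparable.lintegral_law`). More generally, any `l` whose exponential is normalized for each POVM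
defines an auxiliary law of the data through `weight l`, and all arguments compare such densities.

Adaptivity does not help because an entropy bound valid for every POVM holds in each step
conditionally on the past. An exponential Markov inequality turns it into a tail bound uniform over
all strategies (`exists_tail_bound`), and a change of measure turns that into a lower bound on error
probabilities (`eventually_exp_le_lintegral`). For the Stein converse the auxiliary law is that of
`ρ` itself. For the Hoeffding converse each POVM gets its own tilted distribution, close enough to
`P^M_σ` that accepting the null with probability one half would violate the constraint, and with
relative entropy to `P^M_ρ` barely above the optimum (`Comparable.exists_tilt_param`,
`Comparable.exists_hoeffding_converse`). The Chernoff converse is the Hoeffding converse at a rate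
just above the claimed value. The Han–Kobayashi converse is a direct moment bound with parameter `s
≤ 0` (`Comparable.acceptNull_le`).

These bounds are reached by likelihood ratio tests. For Stein, Chernoff and Hoeffding one optimal
POVM suffices. In the Han–Kobayashi regime the maximum of `φ(s)` over POVMs may have a kink in `s`,
so the required entropy `r` may lie strictly between those of two maximizers. Mixing these two at
random attains `r`, and connectedness of the half-line supplies the right `s` unless `r` is too
large for any `s`, where a damped test and `s → -∞` take over
(`Comparable.hanKobayashi_twoPoint_le_iSup`).

Optima over POVMs exist since the relevant functionals are additive and homogeneous in the effects:
Carathéodory's argument bounds the number of outcomes (`exists_subfamily_card_le`), leaving a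
continuous problem on a compact set (`isCompact_boundedPOVM`). -/

/-! ### Likelihood ratios of effects -/

/-- The probability `Tr A ρ` of the effect `A` in the state `ρ`. -/
def prob {d : ℕ} (ρ : State d) (A : Matrix (Fin d) (Fin d) ℂ) : ℝ := (A * ρ.mat).trace.re

/-- The log-likelihood ratio `log (Tr A σ / Tr A ρ)` of the effect `A`, `0` if `Tr A ρ = 0`. -/
def logRatio {d : ℕ} (ρ σ : State d) (A : Matrix (Fin d) (Fin d) ℂ) : ℝ :=
  if prob ρ A = 0 then 0 else Real.log (prob σ A / prob ρ A)

theorem prob_nonneg {d : ℕ} (ρ : State d) {A : Matrix (Fin d) (Fin d) ℂ} (hA : A.PosSemidef) :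
    0 ≤ prob ρ A :=
  (Complex.le_def.1 (trace_mul_nonneg hA ρ.posSemidef)).1

theorem prob_zero {d : ℕ} (ρ : State d) : prob ρ 0 = 0 := by simp [prob]

theorem prob_smul {d : ℕ} (ρ : State d) (t : ℝ) (A : Matrix (Fin d) (Fin d) ℂ) :
    prob ρ (t • A) = t * prob ρ A := by simp [prob]

theorem prob_one {d : ℕ} (ρ : State d) : prob ρ 1 = 1 := by simp [prob, ρ.trace_eq_one]

theorem continuous_prob {d : ℕ} (ρ : State d) : Continuous (prob ρ) := by
  unfold prob
  fun_prop

theorem logRatio_smul {d : ℕ} (ρ σ : State d) {t : ℝ} (ht : t ≠ 0)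
    (A : Matrix (Fin d) (Fin d) ℂ) : logRatio ρ σ (t • A) = logRatio ρ σ A := by
  simp only [logRatio, prob_smul, mul_eq_zero, ht, false_or]
  rw [mul_div_mul_left _ _ ht]

theorem State.nonempty {d : ℕ} (ρ : State d) : Nonempty (Fin d) := by
  rcases Nat.eq_zero_or_pos d with rfl | h
  · have := ρ.trace_eq_one
    simp [Matrix.trace] at this
  · exact ⟨⟨0, h⟩⟩

-- A positive definite `υ` dominates some `c • 1` with `c > 0`, while `τ` is dominated by its norm
-- times `1`. The added `1` in the constant only ensures positivity.
open scoped MatrixOrder Matrix.Norms.L2Operator in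
theorem exists_prob_le {d : ℕ} (τ υ : State d) (hυ : υ.mat.PosDef) :
    ∃ C : ℝ, 0 < C ∧ ∀ A : Matrix (Fin d) (Fin d) ℂ, A.PosSemidef → prob τ A ≤ C * prob υ A := by
  have hsa : IsSelfAdjoint υ.mat := hυ.1
  have : Nonempty (Fin d) := υ.nonempty
  obtain ⟨c, hc, hcυ⟩ := (CFC.exists_pos_algebraMap_le_iff hsa).2
    fun x hx => hυ.isStrictlyPositive.spectrum_pos hx
  have hτ : τ.mat ≤ algebraMap ℝ (Matrix (Fin d) (Fin d) ℂ) ‖τ.mat‖ :=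
    IsSelfAdjoint.le_algebraMap_norm_self (a := τ.mat) τ.posSemidef.1
  refine ⟨(‖τ.mat‖ + 1) / c, by positivity, fun A hA => ?_⟩
  have key : ∀ {B C : Matrix (Fin d) (Fin d) ℂ}, B ≤ C → (A * B).trace.re ≤ (A * C).trace.re := by
    intro B C h
    have := (Complex.le_def.1 (trace_mul_nonneg hA (Matrix.le_iff.1 h))).1
    rw [mul_sub, Matrix.trace_sub] at this
    simpa using this
  have h1 := key hτ
  have h2 := key hcυ
  have h3 := hA.trace_nonneg
  have h4 := (Complex.le_def.1 h3).1
  rw [Algebra.algebraMap_eq_smul_one, Matrix.mul_smul, mul_one, Matrix.trace_smul,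
    Complex.smul_re, smul_eq_mul] at h1 h2
  simp only [Complex.zero_re] at h4
  unfold prob
  have h5 : A.trace.re ≤ (A * υ.mat).trace.re / c := by
    rw [le_div_iff₀ hc]; linarith
  calc (A * τ.mat).trace.re ≤ ‖τ.mat‖ * A.trace.re := h1
    _ ≤ (‖τ.mat‖ + 1) * A.trace.re := by nlinarith
    _ ≤ (‖τ.mat‖ + 1) * ((A * υ.mat).trace.re / c) := by gcongr
    _ = _ := by ring

/-- The states `ρ` and `σ` dominate each other with the constant `exp L`. -/
def Comparable {d : ℕ} (ρ σ : State d) (L : ℝ) : Prop :=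
  0 < L ∧ ∀ A : Matrix (Fin d) (Fin d) ℂ, A.PosSemidef →
    prob σ A ≤ Real.exp L * prob ρ A ∧ prob ρ A ≤ Real.exp L * prob σ A

theorem exists_comparable {d : ℕ} (ρ σ : State d) (hρ : ρ.mat.PosDef) (hσ : σ.mat.PosDef) :
    ∃ L, Comparable ρ σ L := by
  obtain ⟨C, hC, h⟩ := exists_prob_le ρ σ hσ
  obtain ⟨C', hC', h'⟩ := exists_prob_le σ ρ hρ
  refine ⟨max 1 (max (Real.log C) (Real.log C')), by positivity, fun A hA => ⟨?_, ?_⟩⟩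
  · refine (h' A hA).trans (mul_le_mul_of_nonneg_right ?_ (prob_nonneg ρ hA))
    rw [← Real.log_le_iff_le_exp hC']
    simp
  · refine (h A hA).trans (mul_le_mul_of_nonneg_right ?_ (prob_nonneg σ hA))
    rw [← Real.log_le_iff_le_exp hC]
    simp

section
variable {d : ℕ} {ρ σ : State d} {L : ℝ}

theorem Comparable.prob_pos (h : Comparable ρ σ L) {A : Matrix (Fin d) (Fin d) ℂ}
    (hA : A.PosSemidef) (h0 : prob ρ A ≠ 0) : 0 < prob ρ A ∧ 0 < prob σ A := by
  have h1 : 0 < prob ρ A := lt_of_le_of_ne (prob_nonneg ρ hA) (Ne.symm h0)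
  refine ⟨h1, ?_⟩
  by_contra hq
  have := (h.2 A hA).2
  have := Real.exp_pos L
  nlinarith

theorem Comparable.abs_logRatio_le (h : Comparable ρ σ L) {A : Matrix (Fin d) (Fin d) ℂ}
    (hA : A.PosSemidef) : |logRatio ρ σ A| ≤ L := by
  unfold logRatio
  split_ifs with h0
  · simpa using h.1.le
  obtain ⟨hp, hq⟩ := h.prob_pos hA h0
  obtain ⟨h1, h2⟩ := h.2 A hA
  rw [abs_le]
  constructor
  · rw [Real.le_log_iff_exp_le (by positivity), le_div_iff₀ hp, Real.exp_neg, inv_mul_le_iff₀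
      (Real.exp_pos L)]
    exact h2
  · rw [Real.log_le_iff_le_exp (by positivity), div_le_iff₀ hp]
    exact h1

theorem Comparable.prob_eq (h : Comparable ρ σ L) {A : Matrix (Fin d) (Fin d) ℂ}
    (hA : A.PosSemidef) : prob σ A = prob ρ A * Real.exp (logRatio ρ σ A) := by
  unfold logRatio
  split_ifs with h0
  · have h1 := (h.2 A hA).1
    have h2 := prob_nonneg σ hA
    rw [h0] at h1 ⊢
    simp at h1 ⊢
    linarith
  obtain ⟨hp, hq⟩ := h.prob_pos hA h0
  rw [Real.exp_log (by positivity)]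
  field_simp

/-- Functions `A ↦ Tr A ρ · g (s, log (Tr A σ / Tr A ρ))` are continuous also where `Tr A ρ`
vanishes. -/
theorem Comparable.continuousOn_prob_mul (h : Comparable ρ σ L) {g : ℝ × ℝ → ℝ}
    (hg : Continuous g) :
    ContinuousOn (fun x : ℝ × Matrix (Fin d) (Fin d) ℂ =>
      prob ρ x.2 * g (x.1, logRatio ρ σ x.2)) (Set.univ ×ˢ {A | A.PosSemidef}) := by
  rintro ⟨s, A⟩ ⟨-, hA⟩
  have hp : Tendsto (fun x : ℝ × Matrix (Fin d) (Fin d) ℂ => prob ρ x.2)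
      (𝓝[Set.univ ×ˢ {A | A.PosSemidef}] (s, A)) (𝓝 (prob ρ A)) :=
    ((continuous_prob ρ).comp continuous_snd).continuousWithinAt
  by_cases h0 : prob ρ A = 0
  -- The log-ratio may be discontinuous here but stays in `[-L, L]`, so the factor `g` is locally
  -- bounded and the vanishing probability forces the product to `0`.
  · obtain ⟨C, hC⟩ := ((isCompact_closedBall s 1).prod
      (isCompact_Icc (a := -L) (b := L))).exists_bound_of_continuousOn hg.continuousOn
    unfold ContinuousWithinAt
    simp only [h0, zero_mul]
    rw [h0] at hp
    refine hp.zero_mul_isBoundedUnder_le ⟨C, ?_⟩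
    rw [eventually_map]
    have h1 : ∀ᶠ x : ℝ × Matrix (Fin d) (Fin d) ℂ in
        𝓝[Set.univ ×ˢ {A | A.PosSemidef}] (s, A), x.1 ∈ Metric.closedBall s 1 :=
      (continuous_fst.tendsto (s, A)).mono_left nhdsWithin_le_nhds
        (Metric.closedBall_mem_nhds s one_pos)
    filter_upwards [h1, self_mem_nhdsWithin] with x hx hx'
    exact hC _ ⟨hx, abs_le.1 (h.abs_logRatio_le hx'.2)⟩
  · obtain ⟨hp0, hq0⟩ := h.prob_pos hA h0
    have hev : (fun x : ℝ × Matrix (Fin d) (Fin d) ℂ =>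
        prob ρ x.2 * g (x.1, Real.log (prob σ x.2 / prob ρ x.2))) =ᶠ[𝓝 (s, A)]
        fun x => prob ρ x.2 * g (x.1, logRatio ρ σ x.2) := by
      have : ∀ᶠ x : ℝ × Matrix (Fin d) (Fin d) ℂ in 𝓝 (s, A), prob ρ x.2 ≠ 0 :=
        ((continuous_prob ρ).comp continuous_snd).continuousAt.eventually_ne h0
      filter_upwards [this] with x hx
      simp [logRatio, hx]
    refine (ContinuousAt.congr ?_ hev).continuousWithinAt
    have h1 : ContinuousAt (fun x : ℝ × Matrix (Fin d) (Fin d) ℂ => prob ρ x.2) (s, A) :=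
      ((continuous_prob ρ).comp continuous_snd).continuousAt
    have h2 : ContinuousAt (fun x : ℝ × Matrix (Fin d) (Fin d) ℂ => prob σ x.2) (s, A) :=
      ((continuous_prob σ).comp continuous_snd).continuousAt
    have h3 := (h2.div h1 h0).log (div_pos hq0 hp0).ne'
    exact h1.mul (hg.continuousAt.comp (continuousAt_fst.prodMk h3))

end

/-! ### Reduction of the number of outcomes -/

/-- Carathéodory reduction: a finite family of positive semidefinite matrices can be replaced by one
with at most `dim` members and the same sum without decreasing a positively homogeneous additive
functional. -/
theorem exists_subfamily_card_le {d : ℕ} {ι : Type*} (g : Matrix (Fin d) (Fin d) ℂ → ℝ)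
    (hg : ∀ t : ℝ, 0 ≤ t → ∀ B, g (t • B) = t * g B) (s : Finset ι) :
    ∀ A : ι → Matrix (Fin d) (Fin d) ℂ, (∀ i ∈ s, (A i).PosSemidef) →
    ∃ (s' : Finset ι) (A' : ι → Matrix (Fin d) (Fin d) ℂ),
      s'.card ≤ Module.finrank ℝ (Matrix (Fin d) (Fin d) ℂ) ∧ (∀ i ∈ s', (A' i).PosSemidef) ∧
      ∑ i ∈ s', A' i = ∑ i ∈ s, A i ∧ ∑ i ∈ s, g (A i) ≤ ∑ i ∈ s', g (A' i) := by
  classical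
  induction hn : s.card generalizing s with
  | zero => exact fun A hA => ⟨s, A, by omega, hA, rfl, le_rfl⟩
  | succ n ih =>
    intro A hA
    by_cases hN : s.card ≤ Module.finrank ℝ (Matrix (Fin d) (Fin d) ℂ)
    · exact ⟨s, A, hN, hA, rfl, le_rfl⟩
    -- A nonnegative reweighting that kills one member reduces to a smaller family, because `g` is
    -- homogeneous.
    suffices H : ∃ c : ι → ℝ, (∀ i ∈ s, 0 ≤ c i) ∧ (∃ i ∈ s, c i = 0) ∧
        ∑ i ∈ s, c i • A i = ∑ i ∈ s, A i ∧ ∑ i ∈ s, g (A i) ≤ ∑ i ∈ s, c i * g (A i) by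
      obtain ⟨c, hc, ⟨i, hi, hi0⟩, h1, h2⟩ := H
      obtain ⟨s', A', h3, h4, h5, h6⟩ := ih (s.erase i) (by rw [Finset.card_erase_of_mem hi, hn]; rfl)
        (fun j => c j • A j)
        (fun j hj => (hA j (Finset.mem_of_mem_erase hj)).smul (hc j (Finset.mem_of_mem_erase hj)))
      refine ⟨s', A', h3, h4, ?_, ?_⟩
      · rw [h5, ← h1, ← Finset.add_sum_erase s _ hi, hi0, zero_smul, zero_add]
      · refine h2.trans (le_trans (le_of_eq ?_) h6)
        rw [← Finset.add_sum_erase s _ hi, hi0, zero_mul, zero_add]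
        exact Finset.sum_congr rfl fun j hj => (hg _ (hc j (Finset.mem_of_mem_erase hj)) _).symm
    by_cases hz : ∃ i ∈ s, A i = 0
    · obtain ⟨i, hi, hi0⟩ := hz
      have hg0 : g 0 = 0 := by simpa using hg 0 le_rfl 0
      refine ⟨fun j => if j = i then 0 else 1, fun j _ => by positivity, ⟨i, hi, by simp⟩, ?_, ?_⟩
      · refine Finset.sum_congr rfl fun j _ => ?_
        by_cases hj : j = i
        · simp [hj, hi0]
        · simp [hj]
      · refine le_of_eq (Finset.sum_congr rfl fun j _ => ?_)
        by_cases hj : j = i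
        · simp [hj, hi0, hg0]
        · simp [hj]
    push Not at hz
    obtain ⟨c, hc0, ⟨i, hi, hci⟩, hcg⟩ : ∃ c : ι → ℝ, ∑ i ∈ s, c i • A i = 0 ∧
        (∃ i ∈ s, c i ≠ 0) ∧ 0 ≤ ∑ i ∈ s, c i * g (A i) := by
      have hdep : ¬ LinearIndepOn ℝ A (s : Set ι) := by
        intro h
        have := LinearIndependent.fintype_card_le_finrank h
        simp at this hN
        omega
      rw [linearIndepOn_finset_iff] at hdep
      push Not at hdep
      obtain ⟨c, h1, h2⟩ := hdep
      -- The sign of the dependency is free; it is chosen so that moving along it does not decrease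
      -- the functional.
      rcases le_total 0 (∑ i ∈ s, c i * g (A i)) with h3 | h3
      · exact ⟨c, h1, h2, h3⟩
      · refine ⟨fun i => - c i, by simp [h1], by simpa using h2, by simpa using h3⟩
    have htr : ∀ j ∈ s, 0 < (A j).trace.re := by
      intro j hj
      have h1 := Complex.le_def.1 (hA j hj).trace_nonneg
      refine lt_of_le_of_ne (by simpa using h1.1) fun h => hz j hj ?_
      rw [← (hA j hj).trace_eq_zero_iff]
      exact Complex.ext h.symm (by simpa using h1.2.symm)
    have htr0 : ∑ j ∈ s, c j * (A j).trace.re = 0 := by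
      have := congrArg (fun B => (Matrix.trace B).re) hc0
      simpa [Matrix.trace_sum] using this
    obtain ⟨m, hm, hmin⟩ := s.exists_min_image c ⟨i, hi⟩
    -- All traces are strictly positive, so a nontrivial dependency must have a negative
    -- coefficient.
    have hneg : c m < 0 := by
      by_contra hcm
      have hall : ∀ j ∈ s, 0 ≤ c j := fun j hj => (not_lt.1 hcm).trans (hmin j hj)
      have := (Finset.sum_eq_zero_iff_of_nonneg
        (fun j hj => mul_nonneg (hall j hj) (htr j hj).le)).1 htr0 i hi
      rcases mul_eq_zero.1 this with h | h
      · exact hci h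
      · exact (htr i hi).ne' h
    -- Move along the dependency until the first weight vanishes, which happens at the most negative
    -- coefficient.
    refine ⟨fun j => 1 + c j / (-c m), fun j hj => ?_, ⟨m, hm, ?_⟩, ?_, ?_⟩
    · have : -1 ≤ c j / (-c m) := by
        rw [le_div_iff₀ (by linarith)]
        linarith [hmin j hj]
      linarith
    · simp [div_neg, div_self hneg.ne]
    · simp only [add_smul, one_smul, Finset.sum_add_distrib, div_eq_inv_mul, mul_smul]
      rw [← Finset.smul_sum, hc0, smul_zero, add_zero]
    · simp only [add_mul, one_mul, Finset.sum_add_distrib, div_eq_inv_mul, mul_assoc]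
      rw [← Finset.mul_sum]
      have : 0 ≤ (-c m)⁻¹ * ∑ i ∈ s, c i * g (A i) :=
        mul_nonneg (inv_nonneg.2 (by linarith)) hcg
      linarith

/-- The number of outcomes that suffices for all optimizations over POVMs. -/
abbrev outcomeBound (d : ℕ) : ℕ := Module.finrank ℝ (Matrix (Fin d) (Fin d) ℂ)

/-- The POVMs with `outcomeBound d` outcomes, as families of matrices. -/
def boundedPOVM (d : ℕ) : Set (Fin (outcomeBound d) → Matrix (Fin d) (Fin d) ℂ) :=
  {A | (∀ i, (A i).PosSemidef) ∧ ∑ i, A i = 1}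

/-- The POVM of a family of matrices. -/
def POVM.ofFamily {d : ℕ} (A : boundedPOVM d) : POVM d where
  effect := Finsupp.embDomain Fin.valEmbedding (Finsupp.equivFunOnFinite.symm A.1)
  posSemidef y := by
    by_cases hy : y ∈ Set.range (Fin.valEmbedding (n := outcomeBound d))
    · obtain ⟨i, rfl⟩ := hy
      rw [Finsupp.embDomain_apply_self]
      exact A.2.1 i
    · rw [Finsupp.embDomain_of_notMem_range _ _ _ hy]
      exact Matrix.PosSemidef.zero
  sum_eq_one := by
    rw [Finsupp.sum_embDomain, Finsupp.sum_fintype _ _ (fun _ => rfl)]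
    exact A.2.2

theorem POVM.ofFamily_sum {d : ℕ} (A : boundedPOVM d) (g : Matrix (Fin d) (Fin d) ℂ → ℝ)
    (hg : g 0 = 0) : ((POVM.ofFamily A).effect.sum fun _ B => g B) = ∑ i, g (A.1 i) := by
  unfold POVM.ofFamily
  rw [Finsupp.sum_embDomain, Finsupp.sum_fintype _ _ (fun _ => hg)]
  rfl

theorem exists_ofFamily_ge {d : ℕ} (g : Matrix (Fin d) (Fin d) ℂ → ℝ)
    (hg : ∀ t : ℝ, 0 ≤ t → ∀ B, g (t • B) = t * g B) (M : POVM d) :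
    ∃ A : boundedPOVM d, (M.effect.sum fun _ B => g B) ≤
      (POVM.ofFamily A).effect.sum fun _ B => g B := by
  have hg0 : g 0 = 0 := by simpa using hg 0 le_rfl 0
  obtain ⟨s, A, h1, h2, h3, h4⟩ := exists_subfamily_card_le g hg M.effect.support M.effect
    (fun i _ => M.posSemidef i)
  obtain ⟨e⟩ : Nonempty (s ↪ Fin (outcomeBound d)) :=
    Function.Embedding.nonempty_of_card_le (by simpa using h1)
  let A' : Fin (outcomeBound d) → Matrix (Fin d) (Fin d) ℂ :=
    Function.extend e (fun i => A i) 0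
  have hin : ∀ i : s, A' (e i) = A i := fun i => e.injective.extend_apply _ _ _
  have hout : ∀ j, j ∉ Set.range e → A' j = 0 := fun j hj =>
    Function.extend_apply' _ _ _ (by simpa using hj)
  have hA' : A' ∈ boundedPOVM d := by
    constructor
    · intro j
      by_cases hj : j ∈ Set.range e
      · obtain ⟨i, rfl⟩ := hj
        rw [hin]
        exact h2 _ i.2
      · rw [hout j hj]
        exact Matrix.PosSemidef.zero
    · rw [← Fintype.sum_of_injective e e.injective (fun i => A i) A' hout (fun i => (hin i).symm),
        Finset.sum_coe_sort s A, h3]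
      exact M.sum_eq_one
  refine ⟨⟨A', hA'⟩, h4.trans (le_of_eq ?_)⟩
  rw [POVM.ofFamily_sum _ _ hg0, ← Finset.sum_coe_sort s fun i => g (A i)]
  exact Fintype.sum_of_injective e e.injective _ _ (fun j hj => by simp only [hout j hj, hg0])
    (fun i => by simp only [hin i])

-- Positivity and the sum condition are closed, and each effect lies between `0` and `1`, hence has
-- norm at most one.
open scoped MatrixOrder Matrix.Norms.L2Operator in
theorem isCompact_boundedPOVM (d : ℕ) : IsCompact (boundedPOVM d) := by
  have : ProperSpace (Matrix (Fin d) (Fin d) ℂ) := FiniteDimensional.proper ℂ _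
  refine Metric.isCompact_of_isClosed_isBounded ?_ ?_
  · have h1 : IsClosed {A : Matrix (Fin d) (Fin d) ℂ | A.PosSemidef} := by
      have : {A : Matrix (Fin d) (Fin d) ℂ | A.PosSemidef} = Set.Ici 0 := by
        ext A
        exact Matrix.nonneg_iff_posSemidef.symm
      rw [this]
      exact CStarAlgebra.isClosed_nonneg
    have h2 : boundedPOVM d =
        (⋂ i, (fun A => A i) ⁻¹' {A : Matrix (Fin d) (Fin d) ℂ | A.PosSemidef}) ∩
          {A | ∑ i, A i = 1} := by
      ext A
      simp [boundedPOVM]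
    rw [h2]
    exact (isClosed_iInter fun i => h1.preimage (continuous_apply i)).inter
      (isClosed_eq (by fun_prop) continuous_const)
  · refine (Metric.isBounded_iff_subset_closedBall 0).2 ⟨1, fun A hA => ?_⟩
    rw [mem_closedBall_zero_iff, pi_norm_le_iff_of_nonneg zero_le_one]
    intro i
    have h0 : ∀ j, 0 ≤ A j := fun j => (hA.1 j).nonneg
    rw [CStarAlgebra.norm_le_one_iff_of_nonneg _ (h0 i), ← hA.2]
    exact Finset.single_le_sum (fun j _ => h0 j) (Finset.mem_univ i)

/-! ### Expectations of functions of the outcome -/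

/-- The expectation of `f` under the outcome distribution `P^M_ρ`. -/
def mean {d : ℕ} (ρ : State d) (M : POVM d) (f : ℕ → ℝ) : ℝ :=
  ∑ y ∈ M.effect.support, prob ρ (M.effect y) * f y

/-- The log-likelihood ratio `log (P^M_σ(y) / P^M_ρ(y))`. -/
def llr {d : ℕ} (ρ σ : State d) (x : POVM d × ℕ) : ℝ := logRatio ρ σ (x.1.effect x.2)

section
variable {d : ℕ} (ρ σ : State d) (M : POVM d)

theorem mean_add (f g : ℕ → ℝ) : mean ρ M (fun y => f y + g y) = mean ρ M f + mean ρ M g := by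
  simp [mean, mul_add, Finset.sum_add_distrib]

theorem mean_const_mul (c : ℝ) (f : ℕ → ℝ) : mean ρ M (fun y => c * f y) = c * mean ρ M f := by
  simp only [mean, Finset.mul_sum]
  exact Finset.sum_congr rfl fun y _ => by ring

theorem mean_const (c : ℝ) : mean ρ M (fun _ => c) = c := by
  have h : ∑ y ∈ M.effect.support, M.effect y = 1 := M.sum_eq_one
  have h1 : ∑ y ∈ M.effect.support, prob ρ (M.effect y) = 1 := by
    rw [← prob_one ρ, ← h]
    simp [prob, Finset.sum_mul, Matrix.trace_sum]
  rw [mean, ← Finset.sum_mul, h1, one_mul]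

variable {ρ M} in
theorem mean_mono {f g : ℕ → ℝ} (h : ∀ y, f y ≤ g y) : mean ρ M f ≤ mean ρ M g :=
  Finset.sum_le_sum fun y _ => mul_le_mul_of_nonneg_left (h y) (prob_nonneg ρ (M.posSemidef y))

theorem outcome_apply (y : ℕ) : outcome ρ M y = ENNReal.ofReal (prob ρ (M.effect y)) := rfl

theorem prob_eq_toReal_outcome (y : ℕ) : prob ρ (M.effect y) = (outcome ρ M y).toReal := by
  rw [outcome_apply, ENNReal.toReal_ofReal (prob_nonneg ρ (M.posSemidef y))]

variable {ρ M} in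
theorem tsum_outcome_mul {f : ℕ → ℝ} (hf : ∀ y, 0 ≤ f y) :
    ∑' y, outcome ρ M y * ENNReal.ofReal (f y) = ENNReal.ofReal (mean ρ M f) := by
  rw [tsum_eq_sum (s := M.effect.support) (fun y hy => by
      rw [outcome_apply, Finsupp.notMem_support_iff.1 hy, prob_zero]; simp), mean,
    ENNReal.ofReal_sum_of_nonneg
      (fun y _ => mul_nonneg (prob_nonneg ρ (M.posSemidef y)) (hf y))]
  exact Finset.sum_congr rfl fun y _ => by
    rw [outcome_apply, ENNReal.ofReal_mul (prob_nonneg ρ (M.posSemidef y))]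

theorem hasSum_mean (f : ℕ → ℝ) :
    HasSum (fun y => prob ρ (M.effect y) * f y) (mean ρ M f) :=
  hasSum_sum_of_ne_finset_zero fun y hy => by
    rw [Finsupp.notMem_support_iff.1 hy, prob_zero, zero_mul]

end

theorem measurable_prob_effect {d : ℕ} (ρ : State d) (y : ℕ) :
    Measurable fun M : POVM d => prob ρ (M.effect y) := by
  simp only [prob_eq_toReal_outcome]
  exact (measurable_outcome ρ y).ennreal_toReal

theorem measurable_llr {d : ℕ} (ρ σ : State d) : Measurable (llr ρ σ) := by
  refine measurable_from_prod_countable_left fun y => ?_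
  refine Measurable.ite ?_ measurable_const ?_
  · exact measurable_prob_effect ρ y (measurableSet_singleton 0)
  · exact ((measurable_prob_effect σ y).div (measurable_prob_effect ρ y)).log

theorem measurable_mean {d : ℕ} (ρ : State d) {f : POVM d × ℕ → ℝ} (hf : Measurable f) :
    Measurable fun M : POVM d => mean ρ M fun y => f (M, y) := by
  -- The support of the effects varies with `M`, so the sum is taken as a limit of sums over fixed
  -- ranges.
  refine measurable_of_tendsto_metrizable (f := fun n M =>
    ∑ y ∈ Finset.range n, prob ρ (POVM.effect M y) * f (M, y)) (fun n => ?_) ?_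
  · refine Finset.measurable_sum _ fun y _ => (measurable_prob_effect ρ y).mul ?_
    exact hf.comp (measurable_id.prodMk measurable_const)
  · rw [tendsto_pi_nhds]
    exact fun M => (hasSum_mean ρ M _).tendsto_sum_nat

section
variable {d : ℕ} {ρ σ : State d} {L : ℝ}

theorem Comparable.abs_llr_le (h : Comparable ρ σ L) (x : POVM d × ℕ) : |llr ρ σ x| ≤ L :=
  h.abs_logRatio_le (x.1.posSemidef x.2)

theorem Comparable.mean_eq (h : Comparable ρ σ L) (M : POVM d) (f : ℕ → ℝ) :
    mean σ M f = mean ρ M fun y => Real.exp (llr ρ σ (M, y)) * f y :=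
  Finset.sum_congr rfl fun y _ => by
    rw [h.prob_eq (M.posSemidef y)]
    exact mul_assoc _ _ _

theorem Comparable.outcome_eq (h : Comparable ρ σ L) (M : POVM d) (y : ℕ) :
    outcome σ M y = outcome ρ M y * ENNReal.ofReal (Real.exp (llr ρ σ (M, y))) := by
  rw [outcome_apply, outcome_apply, ← ENNReal.ofReal_mul (prob_nonneg ρ (M.posSemidef y)),
    h.prob_eq (M.posSemidef y), llr]

end

/-! ### Tilted distributions -/

/-- `∑_y P^M_ρ(y)^{1-s} P^M_σ(y)^s`. -/
def partZ {d : ℕ} (ρ σ : State d) (s : ℝ) (M : POVM d) : ℝ :=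
  mean ρ M fun y => Real.exp (s * llr ρ σ (M, y))

/-- The derivative of `partZ` in `s`. -/
def partZDeriv {d : ℕ} (ρ σ : State d) (s : ℝ) (M : POVM d) : ℝ :=
  mean ρ M fun y => llr ρ σ (M, y) * Real.exp (s * llr ρ σ (M, y))

/-- `φ(s|P^M_ρ‖P^M_σ)` as a real number. -/
def logZ {d : ℕ} (ρ σ : State d) (s : ℝ) (M : POVM d) : ℝ := Real.log (partZ ρ σ s M)

/-- The log-density, with respect to `P^M_ρ`, of the distribution proportional to
`P^M_ρ(y)^{1-s} P^M_σ(y)^s`. -/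
def tiltLog {d : ℕ} (ρ σ : State d) (s : ℝ) (x : POVM d × ℕ) : ℝ :=
  s * llr ρ σ x - logZ ρ σ s x.1

/-- The relative entropy of the tilted distribution with respect to `P^M_σ`. -/
def klAlt {d : ℕ} (ρ σ : State d) (s : ℝ) (M : POVM d) : ℝ :=
  (s - 1) * (partZDeriv ρ σ s M / partZ ρ σ s M) - logZ ρ σ s M

/-- The relative entropy of the tilted distribution with respect to `P^M_ρ`. -/
def klNull {d : ℕ} (ρ σ : State d) (s : ℝ) (M : POVM d) : ℝ :=
  s * (partZDeriv ρ σ s M / partZ ρ σ s M) - logZ ρ σ s M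

section
variable {d : ℕ} {ρ σ : State d} {L : ℝ}

theorem Comparable.abs_mul_llr_le (h : Comparable ρ σ L) (s : ℝ) (x : POVM d × ℕ) :
    |s * llr ρ σ x| ≤ |s| * L := by
  rw [abs_mul]
  exact mul_le_mul_of_nonneg_left (h.abs_llr_le x) (abs_nonneg s)

theorem Comparable.exp_le_partZ (h : Comparable ρ σ L) (s : ℝ) (M : POVM d) :
    Real.exp (-(|s| * L)) ≤ partZ ρ σ s M := by
  rw [← mean_const ρ M (Real.exp (-(|s| * L)))]
  exact mean_mono fun y => Real.exp_le_exp.2 (abs_le.1 (h.abs_mul_llr_le s _)).1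

theorem Comparable.partZ_le_exp (h : Comparable ρ σ L) (s : ℝ) (M : POVM d) :
    partZ ρ σ s M ≤ Real.exp (|s| * L) := by
  rw [← mean_const ρ M (Real.exp (|s| * L))]
  exact mean_mono fun y => Real.exp_le_exp.2 (abs_le.1 (h.abs_mul_llr_le s _)).2

theorem Comparable.partZ_pos (h : Comparable ρ σ L) (s : ℝ) (M : POVM d) : 0 < partZ ρ σ s M :=
  (Real.exp_pos _).trans_le (h.exp_le_partZ s M)

theorem Comparable.exp_logZ (h : Comparable ρ σ L) (s : ℝ) (M : POVM d) :
    Real.exp (logZ ρ σ s M) = partZ ρ σ s M := Real.exp_log (h.partZ_pos s M)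

theorem Comparable.abs_logZ_le (h : Comparable ρ σ L) (s : ℝ) (M : POVM d) :
    |logZ ρ σ s M| ≤ |s| * L := by
  rw [abs_le, logZ, Real.le_log_iff_exp_le (h.partZ_pos s M),
    Real.log_le_iff_le_exp (h.partZ_pos s M)]
  exact ⟨h.exp_le_partZ s M, h.partZ_le_exp s M⟩

theorem partZ_zero (M : POVM d) : partZ ρ σ 0 M = 1 := by
  simp [partZ, mean_const]

theorem Comparable.partZ_one (h : Comparable ρ σ L) (M : POVM d) : partZ ρ σ 1 M = 1 := by
  have := h.mean_eq M fun _ => 1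
  rw [mean_const] at this
  simpa [partZ] using this.symm

theorem logZ_zero (M : POVM d) : logZ ρ σ 0 M = 0 := by simp [logZ, partZ_zero]

/-- Comparison with `s = 1`, where the sum is `1`. The linear vanishing as `s → 1` is what keeps the
Hoeffding optimum away from the singularity of `1 / (1 - s)`. -/
theorem Comparable.neg_logZ_le (h : Comparable ρ σ L) {s : ℝ} (hs : s ≤ 1) (M : POVM d) :
    -logZ ρ σ s M ≤ (1 - s) * L := by
  have h1 : Real.exp (-((1 - s) * L)) ≤ partZ ρ σ s M := by
    have : Real.exp (-((1 - s) * L)) * partZ ρ σ 1 M ≤ partZ ρ σ s M := by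
      rw [partZ, ← mean_const_mul]
      refine mean_mono fun y => ?_
      rw [← Real.exp_add]
      refine Real.exp_le_exp.2 ?_
      have := (abs_le.1 (h.abs_llr_le (M, y))).2
      nlinarith
    rwa [h.partZ_one, mul_one] at this
  have := (Real.le_log_iff_exp_le (h.partZ_pos s M)).2 h1
  rw [logZ]
  linarith

theorem Comparable.klAlt_one (h : Comparable ρ σ L) (M : POVM d) : klAlt ρ σ 1 M = 0 := by
  simp [klAlt, logZ, h.partZ_one]

theorem klAlt_zero (M : POVM d) : klAlt ρ σ 0 M = mean ρ M fun y => -llr ρ σ (M, y) := by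
  have := mean_const_mul ρ M (-1) fun y => llr ρ σ (M, y)
  simp [klAlt, partZDeriv, partZ_zero, logZ_zero] at this ⊢
  exact this.symm

theorem klNull_zero (M : POVM d) : klNull ρ σ 0 M = 0 := by
  simp [klNull, logZ_zero]

/-- The link between entropies and the stated formulas: the objective of the Hoeffding and
Han–Kobayashi bounds, evaluated at `r = klAlt`, is a relative entropy. -/
theorem klNull_eq {s : ℝ} (hs : s ≠ 1) (M : POVM d) :
    klNull ρ σ s M = (-s * klAlt ρ σ s M - logZ ρ σ s M) / (1 - s) := by
  have : 1 - s ≠ 0 := sub_ne_zero.2 hs.symm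
  rw [eq_div_iff this, klNull, klAlt]
  ring

/-- Used contrapositively: if `klAlt` is bounded below, then `1 - s` is bounded below uniformly in
the POVM. -/
theorem Comparable.klAlt_le (h : Comparable ρ σ L) {s : ℝ} (hs : s ≤ 1) (M : POVM d) :
    klAlt ρ σ s M ≤ 2 * (1 - s) * L := by
  have h1 := h.neg_logZ_le hs M
  have h2 : -L ≤ partZDeriv ρ σ s M / partZ ρ σ s M := by
    rw [le_div_iff₀ (h.partZ_pos s M), partZ, ← mean_const_mul]
    exact mean_mono fun y => mul_le_mul_of_nonneg_right (abs_le.1 (h.abs_llr_le _)).1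
      (Real.exp_pos _).le
  rw [klAlt]
  nlinarith

theorem Comparable.mean_exp_tiltLog (h : Comparable ρ σ L) (s : ℝ) (M : POVM d) :
    (mean ρ M fun y => Real.exp (tiltLog ρ σ s (M, y))) = 1 := by
  have : ∀ y, Real.exp (tiltLog ρ σ s (M, y)) =
      (partZ ρ σ s M)⁻¹ * Real.exp (s * llr ρ σ (M, y)) := fun y => by
    rw [tiltLog, Real.exp_sub, h.exp_logZ, div_eq_inv_mul]
  simp only [this, mean_const_mul]
  exact inv_mul_cancel₀ (h.partZ_pos s M).ne'

theorem Comparable.mean_exp_tiltLog_mul (h : Comparable ρ σ L) (s a b : ℝ) (M : POVM d) :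
    (mean ρ M fun y => Real.exp (tiltLog ρ σ s (M, y)) * (a * llr ρ σ (M, y) + b)) =
      a * (partZDeriv ρ σ s M / partZ ρ σ s M) + b := by
  have : ∀ y, Real.exp (tiltLog ρ σ s (M, y)) * (a * llr ρ σ (M, y) + b) =
      (a * (partZ ρ σ s M)⁻¹) * (llr ρ σ (M, y) * Real.exp (s * llr ρ σ (M, y))) +
        b * Real.exp (tiltLog ρ σ s (M, y)) := fun y => by
    rw [tiltLog, Real.exp_sub, h.exp_logZ, div_eq_inv_mul]
    ring
  simp only [this, mean_const_mul, mean_add, h.mean_exp_tiltLog]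
  rw [partZDeriv]
  ring

theorem Comparable.mean_tiltLog_sub_llr (h : Comparable ρ σ L) (s : ℝ) (M : POVM d) :
    (mean ρ M fun y => Real.exp (tiltLog ρ σ s (M, y)) * (tiltLog ρ σ s (M, y) - llr ρ σ (M, y))) =
      klAlt ρ σ s M := by
  rw [klAlt, sub_eq_add_neg, ← h.mean_exp_tiltLog_mul s (s - 1)]
  congr 1
  ext y
  simp only [tiltLog]
  ring

theorem Comparable.mean_tiltLog (h : Comparable ρ σ L) (s : ℝ) (M : POVM d) :
    (mean ρ M fun y => Real.exp (tiltLog ρ σ s (M, y)) * tiltLog ρ σ s (M, y)) =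
      klNull ρ σ s M := by
  rw [klNull, sub_eq_add_neg, ← h.mean_exp_tiltLog_mul s s]
  congr 1

/-- Gibbs' inequality, from `t * exp t ≥ exp t - 1` and the normalization of the tilted density. -/
theorem Comparable.klNull_nonneg (h : Comparable ρ σ L) (s : ℝ) (M : POVM d) :
    0 ≤ klNull ρ σ s M := by
  have h0 : (mean ρ M fun y => Real.exp (tiltLog ρ σ s (M, y)) + -1) = 0 := by
    rw [mean_add, mean_const, h.mean_exp_tiltLog]
    simp
  rw [← h.mean_tiltLog, ← h0]
  refine mean_mono fun y => ?_
  generalize tiltLog ρ σ s (M, y) = t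
  have h1 := Real.add_one_le_exp (-t)
  have h2 := Real.exp_pos t
  have h3 : Real.exp t * Real.exp (-t) = 1 := by rw [← Real.exp_add]; simp
  nlinarith

theorem Comparable.abs_tiltLog_le (h : Comparable ρ σ L) (s : ℝ) (x : POVM d × ℕ) :
    |tiltLog ρ σ s x| ≤ 2 * |s| * L := by
  have h1 := h.abs_mul_llr_le s x
  have h2 := h.abs_logZ_le s x.1
  rw [abs_le] at *
  rw [tiltLog]
  constructor <;> linarith

theorem Comparable.abs_tiltLog_sub_llr_le (h : Comparable ρ σ L) (s : ℝ) (x : POVM d × ℕ) :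
    |tiltLog ρ σ s x - llr ρ σ x| ≤ (2 * |s| + 1) * L := by
  have h1 := h.abs_tiltLog_le s x
  have h2 := h.abs_llr_le x
  rw [abs_le] at *
  constructor <;> linarith

end

theorem continuous_partZ {d : ℕ} (ρ σ : State d) (M : POVM d) :
    Continuous fun s => partZ ρ σ s M := by
  unfold partZ mean
  fun_prop

theorem continuous_partZDeriv {d : ℕ} (ρ σ : State d) (M : POVM d) :
    Continuous fun s => partZDeriv ρ σ s M := by
  unfold partZDeriv mean
  fun_prop

theorem measurable_partZ {d : ℕ} (ρ σ : State d) (s : ℝ) : Measurable (partZ ρ σ s) :=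
  measurable_mean ρ ((measurable_llr ρ σ).const_mul s).exp

theorem measurable_partZDeriv {d : ℕ} (ρ σ : State d) (s : ℝ) : Measurable (partZDeriv ρ σ s) :=
  measurable_mean ρ ((measurable_llr ρ σ).mul ((measurable_llr ρ σ).const_mul s).exp)

theorem measurable_logZ {d : ℕ} (ρ σ : State d) (s : ℝ) : Measurable (logZ ρ σ s) :=
  (measurable_partZ ρ σ s).log

theorem measurable_tiltLog {d : ℕ} (ρ σ : State d) (s : ℝ) : Measurable (tiltLog ρ σ s) :=
  ((measurable_llr ρ σ).const_mul s).sub ((measurable_logZ ρ σ s).comp measurable_fst)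

theorem measurable_klAlt {d : ℕ} (ρ σ : State d) (s : ℝ) : Measurable (klAlt ρ σ s) :=
  (((measurable_partZDeriv ρ σ s).div (measurable_partZ ρ σ s)).const_mul _).sub
    (measurable_logZ ρ σ s)

theorem measurable_klNull {d : ℕ} (ρ σ : State d) (s : ℝ) : Measurable (klNull ρ σ s) :=
  (((measurable_partZDeriv ρ σ s).div (measurable_partZ ρ σ s)).const_mul _).sub
    (measurable_logZ ρ σ s)

section
variable {d : ℕ} {ρ σ : State d} {L : ℝ}

theorem Comparable.continuous_logZ (h : Comparable ρ σ L) (M : POVM d) :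
    Continuous fun s => logZ ρ σ s M :=
  (continuous_partZ ρ σ M).log fun s => (h.partZ_pos s M).ne'

theorem Comparable.continuous_klAlt (h : Comparable ρ σ L) (M : POVM d) :
    Continuous fun s => klAlt ρ σ s M :=
  ((continuous_id.sub continuous_const).mul ((continuous_partZDeriv ρ σ M).div
    (continuous_partZ ρ σ M) fun s => (h.partZ_pos s M).ne')).sub (h.continuous_logZ M)

theorem Comparable.continuous_klNull (h : Comparable ρ σ L) (M : POVM d) :
    Continuous fun s => klNull ρ σ s M :=
  (continuous_id.mul ((continuous_partZDeriv ρ σ M).div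
    (continuous_partZ ρ σ M) fun s => (h.partZ_pos s M).ne')).sub (h.continuous_logZ M)

/-! ### Optimization over POVMs -/

/-- The log-ratio is invariant under scaling of the effect, so each summand is positively
homogeneous and the Carathéodory reduction applies to any `g`. -/
theorem exists_mean_le_ofFamily (g : ℝ → ℝ) (M : POVM d) :
    ∃ A : boundedPOVM d, (mean ρ M fun y => g (llr ρ σ (M, y))) ≤
      mean ρ (.ofFamily A) fun y => g (llr ρ σ (.ofFamily A, y)) := by
  refine exists_ofFamily_ge (fun B => prob ρ B * g (logRatio ρ σ B)) (fun t ht B => ?_) M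
  rcases ht.eq_or_lt with rfl | ht
  · simp [prob_zero]
  · rw [prob_smul, logRatio_smul ρ σ ht.ne']
    ring

theorem exists_partZ_le_ofFamily (s : ℝ) (M : POVM d) :
    ∃ A : boundedPOVM d, partZ ρ σ s M ≤ partZ ρ σ s (.ofFamily A) :=
  exists_mean_le_ofFamily (fun l => Real.exp (s * l)) M

/-- The same reduction with the opposite sign: Chernoff and Hoeffding minimize `φ`, whereas
Han–Kobayashi maximizes it. -/
theorem exists_partZ_ofFamily_le (s : ℝ) (M : POVM d) :
    ∃ A : boundedPOVM d, partZ ρ σ s (.ofFamily A) ≤ partZ ρ σ s M := by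
  obtain ⟨A, hA⟩ := exists_mean_le_ofFamily (ρ := ρ) (σ := σ) (fun l => -1 * Real.exp (s * l)) M
  rw [mean_const_mul, mean_const_mul] at hA
  exact ⟨A, by unfold partZ; linarith⟩

theorem Comparable.exists_logZ_le_ofFamily (h : Comparable ρ σ L) (s : ℝ) (M : POVM d) :
    ∃ A : boundedPOVM d, logZ ρ σ s M ≤ logZ ρ σ s (.ofFamily A) := by
  obtain ⟨A, hA⟩ := exists_partZ_le_ofFamily (ρ := ρ) (σ := σ) s M
  exact ⟨A, Real.log_le_log (h.partZ_pos s M) hA⟩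

theorem Comparable.exists_logZ_ofFamily_le (h : Comparable ρ σ L) (s : ℝ) (M : POVM d) :
    ∃ A : boundedPOVM d, logZ ρ σ s (.ofFamily A) ≤ logZ ρ σ s M := by
  obtain ⟨A, hA⟩ := exists_partZ_ofFamily_le (ρ := ρ) (σ := σ) s M
  exact ⟨A, Real.log_le_log (h.partZ_pos s _) hA⟩

theorem exists_klAlt_zero_le_ofFamily (M : POVM d) :
    ∃ A : boundedPOVM d, klAlt ρ σ 0 M ≤ klAlt ρ σ 0 (.ofFamily A) := by
  simp only [klAlt_zero]
  exact exists_mean_le_ofFamily (fun l => -l) M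

theorem Comparable.continuous_mean_ofFamily (h : Comparable ρ σ L) {g : ℝ × ℝ → ℝ}
    (hg : Continuous g) :
    Continuous fun x : ℝ × boundedPOVM d =>
      mean ρ (.ofFamily x.2) fun y => g (x.1, llr ρ σ (.ofFamily x.2, y)) := by
  have h1 : ∀ x : ℝ × boundedPOVM d,
      (mean ρ (.ofFamily x.2) fun y => g (x.1, llr ρ σ (.ofFamily x.2, y))) =
      ∑ i, prob ρ (x.2.1 i) * g (x.1, logRatio ρ σ (x.2.1 i)) := fun x =>
    POVM.ofFamily_sum x.2 (fun B => prob ρ B * g (x.1, logRatio ρ σ B)) (by simp [prob_zero])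
  simp only [h1]
  refine continuous_finsetSum _ fun i _ => ?_
  exact (h.continuousOn_prob_mul hg).comp_continuous
    (f := fun x : ℝ × boundedPOVM d => (x.1, x.2.1 i)) 
    (continuous_fst.prodMk ((continuous_apply i).comp (continuous_subtype_val.comp continuous_snd)))
    fun x => ⟨trivial, x.2.2.1 i⟩

theorem Comparable.continuous_partZ_ofFamily (h : Comparable ρ σ L) :
    Continuous fun x : ℝ × boundedPOVM d => partZ ρ σ x.1 (.ofFamily x.2) :=
  h.continuous_mean_ofFamily (g := fun x => Real.exp (x.1 * x.2)) (by fun_prop)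

theorem Comparable.continuous_partZDeriv_ofFamily (h : Comparable ρ σ L) :
    Continuous fun x : ℝ × boundedPOVM d => partZDeriv ρ σ x.1 (.ofFamily x.2) :=
  h.continuous_mean_ofFamily (g := fun x => x.2 * Real.exp (x.1 * x.2)) (by fun_prop)

theorem Comparable.continuous_logZ_ofFamily (h : Comparable ρ σ L) :
    Continuous fun x : ℝ × boundedPOVM d => logZ ρ σ x.1 (.ofFamily x.2) :=
  h.continuous_partZ_ofFamily.log fun x => (h.partZ_pos x.1 _).ne'

theorem Comparable.continuous_klAlt_ofFamily (h : Comparable ρ σ L) :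
    Continuous fun x : ℝ × boundedPOVM d => klAlt ρ σ x.1 (.ofFamily x.2) :=
  ((continuous_fst.sub continuous_const).mul (h.continuous_partZDeriv_ofFamily.div
    h.continuous_partZ_ofFamily fun x => (h.partZ_pos x.1 _).ne')).sub h.continuous_logZ_ofFamily

end

instance (d : ℕ) : CompactSpace (boundedPOVM d) :=
  isCompact_iff_compactSpace.1 (isCompact_boundedPOVM d)

theorem nonempty_boundedPOVM {d : ℕ} (ρ : State d) : Nonempty (boundedPOVM d) := by
  let M : POVM d := ⟨Finsupp.single 0 1, fun y => by
    rw [Finsupp.single_apply]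
    split_ifs
    · exact Matrix.PosSemidef.one
    · exact Matrix.PosSemidef.zero, by simp⟩
  obtain ⟨A, -⟩ := exists_partZ_le_ofFamily (ρ := ρ) (σ := ρ) 0 M
  exact ⟨A⟩

section
variable {d : ℕ} {ρ σ : State d} {L : ℝ}

theorem Comparable.exists_max_klAlt_zero (h : Comparable ρ σ L) :
    ∃ M₀, ∀ M, klAlt ρ σ 0 M ≤ klAlt ρ σ 0 M₀ := by
  have := nonempty_boundedPOVM ρ
  obtain ⟨A, -, hA⟩ := isCompact_univ.exists_isMaxOn (Set.univ_nonempty (α := boundedPOVM d))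
    (h.continuous_klAlt_ofFamily.comp (Continuous.prodMk_right (0 : ℝ))).continuousOn
  refine ⟨.ofFamily A, fun M => ?_⟩
  obtain ⟨B, hB⟩ := exists_klAlt_zero_le_ofFamily (ρ := ρ) (σ := σ) M
  exact hB.trans (hA (Set.mem_univ B))

theorem Comparable.exists_max_logZ (h : Comparable ρ σ L) (s : ℝ) :
    ∃ A : boundedPOVM d, ∀ M, logZ ρ σ s M ≤ logZ ρ σ s (.ofFamily A) := by
  have := nonempty_boundedPOVM ρ
  obtain ⟨A, -, hA⟩ := isCompact_univ.exists_isMaxOn (Set.univ_nonempty (α := boundedPOVM d))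
    (h.continuous_logZ_ofFamily.comp (Continuous.prodMk_right s)).continuousOn
  refine ⟨A, fun M => ?_⟩
  obtain ⟨B, hB⟩ := h.exists_logZ_le_ofFamily s M
  exact hB.trans (hA (Set.mem_univ B))

/-- Joint maximization over `s` and the POVM of functions of `s` and `φ(s)` that decrease with `φ(s)`. -/
theorem Comparable.exists_max_comp_logZ (h : Comparable ρ σ L) {S : Set ℝ} (hS : IsCompact S)
    (hne : S.Nonempty) {g : ℝ → ℝ → ℝ} (hg : ContinuousOn (Function.uncurry g) (S ×ˢ Set.univ))
    (hanti : ∀ s ∈ S, Antitone (g s)) :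
    ∃ s₀ ∈ S, ∃ M₀ : POVM d, ∀ s ∈ S, ∀ M, g s (logZ ρ σ s M) ≤ g s₀ (logZ ρ σ s₀ M₀) := by
  have := nonempty_boundedPOVM ρ
  obtain ⟨⟨s₀, A⟩, hs₀, hA⟩ := (hS.prod isCompact_univ).exists_isMaxOn
    (hne.prod (Set.univ_nonempty (α := boundedPOVM d)))
    (f := fun x : ℝ × boundedPOVM d => g x.1 (logZ ρ σ x.1 (.ofFamily x.2)))
    (hg.comp (f := fun x : ℝ × boundedPOVM d => (x.1, logZ ρ σ x.1 (.ofFamily x.2)))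
      (continuous_fst.prodMk h.continuous_logZ_ofFamily).continuousOn
      fun x hx => ⟨hx.1, trivial⟩)
  refine ⟨s₀, hs₀.1, .ofFamily A, fun s hs M => ?_⟩
  obtain ⟨B, hB⟩ := h.exists_logZ_ofFamily_le s M
  exact (hanti s hs hB).trans (hA (⟨hs, trivial⟩ : (s, B) ∈ S ×ˢ Set.univ))

/-! ### The divergences of the statement in terms of real numbers -/

theorem Comparable.measuredPhi_eq (h : Comparable ρ σ L) (s : ℝ) (M : POVM d) :
    measuredPhi s ρ σ M = (logZ ρ σ s M : EReal) := by
  have h1 : ∀ y, outcome ρ M y * (outcome σ M y / outcome ρ M y) ^ s =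
      outcome ρ M y * ENNReal.ofReal (Real.exp (s * llr ρ σ (M, y))) := by
    intro y
    by_cases h0 : outcome ρ M y = 0
    · simp [h0]
    · have htop : outcome ρ M y ≠ ∞ := by simp [outcome_apply]
      rw [h.outcome_eq, mul_comm (outcome ρ M y) (ENNReal.ofReal _),
        ENNReal.mul_div_cancel_right h0 htop, ENNReal.ofReal_rpow_of_pos (Real.exp_pos _),
        ← Real.exp_mul, mul_comm s]
  rw [measuredPhi, phi, tsum_congr h1, tsum_outcome_mul fun y => (Real.exp_pos _).le]
  exact ENNReal.log_ofReal_of_pos (h.partZ_pos s M)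

theorem Comparable.measuredKL_eq (h : Comparable ρ σ L) (M : POVM d) :
    measuredKL ρ σ M = (klAlt ρ σ 0 M : EReal) := by
  have hwd : (outcome ρ M).toMeasure = (outcome σ M).toMeasure.withDensity
      fun y => ENNReal.ofReal (Real.exp (-llr ρ σ (M, y))) := by
    refine Measure.ext_of_singleton fun y => ?_
    rw [withDensity_apply _ (measurableSet_singleton y), lintegral_singleton,
      PMF.toMeasure_apply_singleton _ _ (measurableSet_singleton y),
      PMF.toMeasure_apply_singleton _ _ (measurableSet_singleton y), h.outcome_eq, mul_comm,
      mul_assoc, ← ENNReal.ofReal_mul (Real.exp_pos _).le, ← Real.exp_add]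
    simp
  have hac : (outcome ρ M).toMeasure ≪ (outcome σ M).toMeasure := by
    rw [hwd]
    exact withDensity_absolutelyContinuous _ _
  have hrn : (outcome ρ M).toMeasure.rnDeriv (outcome σ M).toMeasure
      =ᵐ[(outcome σ M).toMeasure] fun y => ENNReal.ofReal (Real.exp (-llr ρ σ (M, y))) := by
    conv_lhs => rw [hwd]
    exact Measure.rnDeriv_withDensity _ measurable_from_nat
  have hkl : InformationTheory.klDiv (outcome ρ M).toMeasure (outcome σ M).toMeasure =
      ENNReal.ofReal (mean σ M fun y =>
        InformationTheory.klFun (Real.exp (-llr ρ σ (M, y)))) := by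
    rw [InformationTheory.klDiv_eq_lintegral_klFun, if_pos hac,
      lintegral_congr_ae (hrn.mono fun y hy => by
        rw [hy, ENNReal.toReal_ofReal (Real.exp_pos _).le]), lintegral_countable',
      ← tsum_outcome_mul fun y => InformationTheory.klFun_nonneg (Real.exp_pos _).le]
    refine tsum_congr fun y => ?_
    rw [PMF.toMeasure_apply_singleton _ _ (measurableSet_singleton y), mul_comm]
  have hnn : 0 ≤ mean σ M fun y => InformationTheory.klFun (Real.exp (-llr ρ σ (M, y))) := by
    rw [← mean_const σ M 0]
    exact mean_mono fun y => InformationTheory.klFun_nonneg (Real.exp_pos _).le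
  have heq : (mean σ M fun y => InformationTheory.klFun (Real.exp (-llr ρ σ (M, y)))) =
      klAlt ρ σ 0 M := by
    -- After passing from `σ` to `ρ`, the correction terms of `klFun` become `exp (llr) - 1`, which
    -- has mean zero.
    have h1 : ∀ y, Real.exp (llr ρ σ (M, y)) *
        InformationTheory.klFun (Real.exp (-llr ρ σ (M, y))) =
        -llr ρ σ (M, y) + (Real.exp (1 * llr ρ σ (M, y)) + -1) := by
      intro y
      have : Real.exp (llr ρ σ (M, y)) * Real.exp (-llr ρ σ (M, y)) = 1 := by
        rw [← Real.exp_add]; simp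
      rw [InformationTheory.klFun, Real.log_exp, one_mul]
      linear_combination (-llr ρ σ (M, y) - 1) * this
    rw [h.mean_eq]
    simp only [h1]
    rw [mean_add, mean_add, mean_const, ← partZ, h.partZ_one, klAlt_zero]
    ring
  rw [measuredKL, hkl, EReal.coe_ennreal_ofReal, max_eq_left hnn, heq]

theorem tilt_coe {r s : ℝ} (a : ℝ) : tilt r s (a : EReal) = ((-s * r - a) / (1 - s) : ℝ) := by
  rw [tilt, ← EReal.coe_sub, ← EReal.coe_div]

end

/-! ### The law of the data -/

instance {d : ℕ} (S : Strategy d) (k : ℕ) : IsMarkovKernel (S.input k) := S.markov k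

theorem measurable_snoc {d n : ℕ} :
    Measurable fun p : Hist d n × (POVM d × ℕ) => (Fin.snoc p.1 p.2 : Hist d (n + 1)) := by
  refine measurable_pi_lambda _ fun i => ?_
  refine Fin.lastCases ?_ (fun j => ?_) i
  · simpa using measurable_snd
  · simp only [Fin.snoc_castSucc]
    exact (measurable_pi_apply j).comp measurable_fst

instance {d : ℕ} (S : Strategy d) (ρ : State d) (n : ℕ) : IsProbabilityMeasure (S.law ρ n) := by
  induction n with
  | zero => exact inferInstanceAs (IsProbabilityMeasure (Measure.dirac _))
  | succ n ih => exact Measure.isProbabilityMeasure_map measurable_snoc.aemeasurable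

theorem lintegral_outcome {d : ℕ} (ρ : State d) (M : POVM d) (g : ℕ → ℝ≥0∞) :
    ∫⁻ y, g y ∂(channel ρ M) = ∑' y, outcome ρ M y * g y := by
  change ∫⁻ y, g y ∂(outcome ρ M).toMeasure = _
  rw [lintegral_countable']
  exact tsum_congr fun y => by
    rw [PMF.toMeasure_apply_singleton _ _ (measurableSet_singleton y), mul_comm]

theorem measurable_tsum_outcome {d n : ℕ} (ρ : State d) {g : Hist d (n + 1) → ℝ≥0∞}
    (hg : Measurable g) :
    Measurable fun p : Hist d n × POVM d =>
      ∑' y, outcome ρ p.2 y * g (Fin.snoc p.1 (p.2, y) : Hist d (n + 1)) := by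
  refine Measurable.tsum fun y => ((measurable_outcome ρ y).comp measurable_snd).mul ?_
  exact hg.comp (measurable_snoc.comp
    (measurable_fst.prodMk (measurable_snd.prodMk measurable_const)))

theorem lintegral_law_succ {d n : ℕ} (S : Strategy d) (ρ : State d)
    {g : Hist d (n + 1) → ℝ≥0∞} (hg : Measurable g) :
    ∫⁻ h, g h ∂(S.law ρ (n + 1)) = ∫⁻ h, ∫⁻ M, ∑' y, outcome ρ M y *
      g (Fin.snoc h (M, y) : Hist d (n + 1)) ∂(S.input n h) ∂(S.law ρ n) := by
  have hg' : Measurable fun p : Hist d n × (POVM d × ℕ) =>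
      g (Fin.snoc p.1 p.2 : Hist d (n + 1)) := hg.comp measurable_snoc
  rw [Strategy.law, lintegral_map hg measurable_snoc, Measure.lintegral_compProd hg']
  refine lintegral_congr fun h => ?_
  rw [Kernel.lintegral_compProd _ _ _ (f := fun x => g (Fin.snoc h x : Hist d (n + 1)))
    (hg'.comp measurable_prodMk_left)]
  refine lintegral_congr fun M => ?_
  rw [Kernel.prodMkLeft_apply, lintegral_outcome]

theorem measurable_sum_hist {d n : ℕ} {l : POVM d × ℕ → ℝ} (hl : Measurable l) :
    Measurable fun h : Hist d n => ∑ k, l (h k) :=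
  Finset.measurable_sum _ fun k _ => hl.comp (measurable_pi_apply k)

/-- The weight of the data `h` under the density `exp l` of each single step. -/
def weight {d n : ℕ} (l : POVM d × ℕ → ℝ) (h : Hist d n) : ℝ≥0∞ :=
  ENNReal.ofReal (Real.exp (∑ k, l (h k)))

theorem measurable_weight {d n : ℕ} {l : POVM d × ℕ → ℝ} (hl : Measurable l) :
    Measurable fun h : Hist d n => weight l h :=
  (measurable_sum_hist hl).exp.ennreal_ofReal

theorem weight_snoc {d n : ℕ} (l : POVM d × ℕ → ℝ) (h : Hist d n) (x : POVM d × ℕ) :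
    weight l (Fin.snoc h x : Hist d (n + 1)) = weight l h * ENNReal.ofReal (Real.exp (l x)) := by
  rw [weight, weight, ← ENNReal.ofReal_mul (Real.exp_pos _).le, ← Real.exp_add,
    Fin.sum_univ_castSucc]
  simp

theorem lintegral_weight_succ {d n : ℕ} (S : Strategy d) (ρ : State d) {l : POVM d × ℕ → ℝ}
    (hl : Measurable l) :
    ∫⁻ h, weight l h ∂(S.law ρ (n + 1)) = ∫⁻ h, weight l h * ∫⁻ M, ∑' y, outcome ρ M y *
      ENNReal.ofReal (Real.exp (l (M, y))) ∂(S.input n h) ∂(S.law ρ n) := by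
  rw [lintegral_law_succ S ρ (measurable_weight hl)]
  refine lintegral_congr fun h => ?_
  simp only [weight_snoc, mul_left_comm _ (weight l h), ENNReal.tsum_mul_left]
  rw [lintegral_const_mul]
  refine Measurable.tsum fun y => (measurable_outcome ρ y).mul ?_
  exact (hl.comp (measurable_id.prodMk measurable_const)).exp.ennreal_ofReal

/-- Integrating out the last step first leaves a factor at most `c`, whatever the past; this is the
only place where adaptivity must be controlled for moment bounds. -/
theorem lintegral_weight_le_pow {d : ℕ} (S : Strategy d) (ρ : State d) {l : POVM d × ℕ → ℝ}
    (hl : Measurable l) {c : ℝ≥0∞}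
    (hc : ∀ k h, ∫⁻ M, ∑' y, outcome ρ M y * ENNReal.ofReal (Real.exp (l (M, y)))
      ∂(S.input k h) ≤ c) (n : ℕ) :
    ∫⁻ h, weight l h ∂(S.law ρ n) ≤ c ^ n := by
  induction n with
  | zero => simp [weight]
  | succ n ih =>
    rw [lintegral_weight_succ S ρ hl, pow_succ]
    calc _ ≤ ∫⁻ h, weight l h * c ∂(S.law ρ n) :=
          lintegral_mono fun h => mul_le_mul_right (hc n h) _
      _ = (∫⁻ h, weight l h ∂(S.law ρ n)) * c := lintegral_mul_const _ (measurable_weight hl)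
      _ ≤ _ := mul_le_mul_left ih _

/-- Normalization for each POVM separately makes `weight l` a probability density for every
strategy, so the tilt may depend on the POVM. -/
theorem lintegral_weight_eq_one {d : ℕ} (S : Strategy d) (ρ : State d) {l : POVM d × ℕ → ℝ}
    (hl : Measurable l) (h1 : ∀ M, (mean ρ M fun y => Real.exp (l (M, y))) = 1) (n : ℕ) :
    ∫⁻ h, weight l h ∂(S.law ρ n) = 1 := by
  induction n with
  | zero => simp [weight]
  | succ n ih =>
    rw [lintegral_weight_succ S ρ hl, ← ih]
    refine lintegral_congr fun h => ?_
    simp [tsum_outcome_mul, Real.exp_nonneg, h1]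

/-- Both laws use the same kernels for drawing POVMs, so only the outcome likelihoods enter the
density. -/
theorem Comparable.lintegral_law {d : ℕ} {ρ σ : State d} {L : ℝ} (hc : Comparable ρ σ L)
    (S : Strategy d) (n : ℕ) {g : Hist d n → ℝ≥0∞} (hg : Measurable g) :
    ∫⁻ h, g h ∂(S.law σ n) = ∫⁻ h, g h * weight (llr ρ σ) h ∂(S.law ρ n) := by
  induction n with
  | zero => simp [weight, Strategy.law]
  | succ n ih =>
    rw [lintegral_law_succ S σ hg, lintegral_law_succ S ρ
      (g := fun h => g h * weight (llr ρ σ) h) (hg.mul (measurable_weight (measurable_llr ρ σ))),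
      ih (Measurable.lintegral_kernel_prod_right' (κ := S.input n) (measurable_tsum_outcome σ hg))]
    refine lintegral_congr fun h => ?_
    rw [mul_comm, ← lintegral_const_mul]
    · refine lintegral_congr fun M => ?_
      rw [← ENNReal.tsum_mul_left]
      refine tsum_congr fun y => ?_
      rw [hc.outcome_eq, weight_snoc]
      ring
    · exact (measurable_tsum_outcome σ hg).comp measurable_prodMk_left

/-! ### Tail bounds and change of measure -/

/-- The conditional cumulant generating function of `D` in each step, under the density `exp l`, is
bounded by `θ G + θ² K²` for small `θ ≥ 0`. -/
def StepBound {d : ℕ} (S : Strategy d) (ρ : State d) (l D : POVM d × ℕ → ℝ) (K G : ℝ) : Prop :=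
  ∀ θ : ℝ, 0 ≤ θ → θ * K ≤ 1 → ∀ k h,
    ∫⁻ M, ∑' y, outcome ρ M y * ENNReal.ofReal (Real.exp (l (M, y) + θ * D (M, y)))
      ∂(S.input k h) ≤ ENNReal.ofReal (Real.exp (θ * G + θ ^ 2 * K ^ 2))

theorem mean_exp_add_le {d : ℕ} {ρ : State d} {M : POVM d} {l D : ℕ → ℝ} {K θ : ℝ}
    (h1 : (mean ρ M fun y => Real.exp (l y)) = 1) (hD : ∀ y, |D y| ≤ K) (hθ : 0 ≤ θ)
    (hK : θ * K ≤ 1) :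
    (mean ρ M fun y => Real.exp (l y + θ * D y)) ≤
      1 + θ * (mean ρ M fun y => Real.exp (l y) * D y) + θ ^ 2 * K ^ 2 := by
  have : ∀ y, Real.exp (l y + θ * D y) ≤
      Real.exp (l y) + (θ * (Real.exp (l y) * D y) + θ ^ 2 * K ^ 2 * Real.exp (l y)) := by
    intro y
    have h2 : |θ * D y| ≤ θ * K := by
      rw [abs_mul, abs_of_nonneg hθ]
      exact mul_le_mul_of_nonneg_left (hD y) hθ
    have h3 := (abs_le.1 (Real.abs_exp_sub_one_sub_id_le (h2.trans hK))).2
    have h4 : (θ * D y) ^ 2 ≤ θ ^ 2 * K ^ 2 := by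
      rw [← mul_pow, ← sq_abs]
      exact pow_le_pow_left₀ (abs_nonneg _) h2 2
    rw [Real.exp_add]
    have := mul_le_mul_of_nonneg_left (h3.trans h4) (Real.exp_pos (l y)).le
    linarith
  refine (mean_mono this).trans (le_of_eq ?_)
  rw [mean_add, mean_add, mean_const_mul, mean_const_mul, h1]
  ring

theorem stepBound_of_mean_le {d : ℕ} (S : Strategy d) (ρ : State d) {l D : POVM d × ℕ → ℝ}
    {K G : ℝ} (h1 : ∀ M, (mean ρ M fun y => Real.exp (l (M, y))) = 1) (hD : ∀ x, |D x| ≤ K)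
    (hG : ∀ M, (mean ρ M fun y => Real.exp (l (M, y)) * D (M, y)) ≤ G) :
    StepBound S ρ l D K G := by
  intro θ hθ hK k h
  have : ∀ M, ∑' y, outcome ρ M y * ENNReal.ofReal (Real.exp (l (M, y) + θ * D (M, y))) ≤
      ENNReal.ofReal (Real.exp (θ * G + θ ^ 2 * K ^ 2)) := by
    intro M
    rw [tsum_outcome_mul fun y => (Real.exp_pos _).le]
    refine ENNReal.ofReal_le_ofReal ((mean_exp_add_le (h1 M) (fun y => hD _) hθ hK).trans ?_)
    have := mul_le_mul_of_nonneg_left (hG M) hθ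
    linarith [Real.add_one_le_exp (θ * G + θ ^ 2 * K ^ 2)]
  refine (lintegral_mono this).trans ?_
  simp

/-- Exponential Markov inequality. The rate depends only on `K` and `ε`, hence is uniform over
strategies, states and densities. -/
theorem exists_tail_bound {d : ℕ} {K ε : ℝ} (hK : 0 < K) (hε : 0 < ε) :
    ∃ η : ℝ, 0 < η ∧ ∀ (S : Strategy d) (ρ : State d) (l D : POVM d × ℕ → ℝ) (G : ℝ),
      Measurable l → Measurable D → StepBound S ρ l D K G → ∀ n : ℕ,
      ∫⁻ h, {h : Hist d n | n * (G + ε) ≤ ∑ k, D (h k)}.indicator (weight l) h ∂(S.law ρ n) ≤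
        ENNReal.ofReal (Real.exp (-(n * η))) := by
  -- The first bound makes the quadratic estimate of the exponential valid, the second lets the
  -- quadratic term use at most half of the gain `θ * ε`.
  set θ := min (1 / K) (ε / (2 * K ^ 2)) with hθdef
  have hθ : 0 < θ := by positivity
  have hθ1 : θ * K ≤ 1 := by
    rw [← le_div_iff₀ hK]
    exact min_le_left _ _
  have hθ2 : θ ^ 2 * K ^ 2 ≤ θ * ε / 2 := by
    have : θ * (2 * K ^ 2) ≤ ε := by
      rw [← le_div_iff₀ (by positivity)]
      exact min_le_right _ _
    nlinarith
  refine ⟨θ * ε / 2, by positivity, fun S ρ l D G hl hD hS n => ?_⟩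
  have hpt : ∀ h : Hist d n, {h : Hist d n | n * (G + ε) ≤ ∑ k, D (h k)}.indicator (weight l) h ≤
      ENNReal.ofReal (Real.exp (-(θ * (n * (G + ε))))) * weight (fun x => l x + θ * D x) h := by
    intro h
    by_cases hh : h ∈ {h : Hist d n | n * (G + ε) ≤ ∑ k, D (h k)}
    · rw [Set.indicator_of_mem hh, weight, weight, ← ENNReal.ofReal_mul (Real.exp_pos _).le,
        ← Real.exp_add, Finset.sum_add_distrib, ← Finset.mul_sum]
      refine ENNReal.ofReal_le_ofReal (Real.exp_le_exp.2 ?_)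
      have := mul_le_mul_of_nonneg_left (show n * (G + ε) ≤ ∑ k, D (h k) from hh) hθ.le
      linarith
    · simp [Set.indicator_of_notMem hh]
  have hm : Measurable fun x => l x + θ * D x := hl.add (hD.const_mul θ)
  calc _ ≤ _ := lintegral_mono hpt
    _ = ENNReal.ofReal (Real.exp (-(θ * (n * (G + ε))))) *
        ∫⁻ h, weight (fun x => l x + θ * D x) h ∂(S.law ρ n) :=
      lintegral_const_mul _ (measurable_weight hm)
    _ ≤ ENNReal.ofReal (Real.exp (-(θ * (n * (G + ε))))) *
        ENNReal.ofReal (Real.exp (θ * G + θ ^ 2 * K ^ 2)) ^ n :=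
      mul_le_mul_right (lintegral_weight_le_pow S ρ hm (hS θ hθ.le hθ1) n) _
    _ ≤ _ := by
      rw [← ENNReal.ofReal_pow (Real.exp_pos _).le, ← ENNReal.ofReal_mul (Real.exp_pos _).le,
        ← Real.exp_nat_mul, ← Real.exp_add]
      refine ENNReal.ofReal_le_ofReal (Real.exp_le_exp.2 ?_)
      have := mul_le_mul_of_nonneg_left hθ2 (Nat.cast_nonneg (α := ℝ) n)
      linarith

theorem eventually_exp_neg_mul_le {η c : ℝ} (hη : 0 < η) (hc : 0 < c) :
    ∀ᶠ n : ℕ in atTop, Real.exp (-(n * η)) ≤ c := by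
  have : Tendsto (fun n : ℕ => Real.exp (-(n * η))) atTop (𝓝 0) :=
    Real.tendsto_exp_neg_atTop_nhds_zero.comp
      (tendsto_natCast_atTop_atTop.atTop_mul_const hη)
  exact this.eventually (eventually_le_nhds hc)

/-- Change of measure: a test function with non-vanishing expectation under the density `exp l`
has at most the exponential rate `G` under the density `exp l'`, where `G` bounds the relative
entropy in each step. -/
theorem eventually_exp_le_lintegral {d : ℕ} {K ε c : ℝ} (hK : 0 < K) (hε : 0 < ε) (hc : 0 < c) :
    ∀ᶠ n : ℕ in atTop, ∀ (S : Strategy d) (ρ : State d) (l l' : POVM d × ℕ → ℝ) (G : ℝ),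
      Measurable l → Measurable l' → StepBound S ρ l (fun x => l x - l' x) K G →
      ∀ g : Hist d n → ℝ≥0∞, (∀ h, g h ≤ 1) →
      ENNReal.ofReal c ≤ ∫⁻ h, g h * weight l h ∂(S.law ρ n) →
      ENNReal.ofReal (Real.exp (-(n * (G + ε)))) ≤ ∫⁻ h, g h * weight l' h ∂(S.law ρ n) := by
  obtain ⟨η, hη, htail⟩ := exists_tail_bound (d := d) hK (half_pos hε)
  filter_upwards [eventually_exp_neg_mul_le hη (show 0 < c / 3 by positivity),
    eventually_exp_neg_mul_le (half_pos hε) (show 0 < c / 3 by positivity)]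
    with n hn1 hn2 S ρ l l' G hl hl' hS g hg hcg
  have ht := htail S ρ l _ G hl (hl.sub hl') hS n
  by_contra hlt
  rw [not_le] at hlt
  -- On this set the tail bound applies; off it, `weight l` exceeds `weight l'` by at most the
  -- factor `exp (n (G + ε / 2))`.
  set E := {h : Hist d n | n * (G + ε / 2) ≤ ∑ k, (l (h k) - l' (h k))} with hE
  have hpt : ∀ h : Hist d n, g h * weight l h ≤ E.indicator (weight l) h +
      ENNReal.ofReal (Real.exp (n * (G + ε / 2))) * (g h * weight l' h) := by
    intro h
    by_cases hh : h ∈ E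
    · rw [Set.indicator_of_mem hh]
      exact le_add_right (mul_le_of_le_one_left (zero_le) (hg h))
    · rw [Set.indicator_of_notMem hh, zero_add, mul_left_comm]
      refine mul_le_mul_right ?_ _
      rw [weight, weight, ← ENNReal.ofReal_mul (Real.exp_pos _).le, ← Real.exp_add]
      refine ENNReal.ofReal_le_ofReal (Real.exp_le_exp.2 ?_)
      have : ∑ k, (l (h k) - l' (h k)) < n * (G + ε / 2) := not_le.1 hh
      rw [Finset.sum_sub_distrib] at this
      linarith
  have hEm : MeasurableSet E := measurableSet_le measurable_const
    (measurable_sum_hist (hl.sub hl'))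
  have h3 : ENNReal.ofReal c ≤ ENNReal.ofReal (c / 3) + ENNReal.ofReal (c / 3) := by
    calc ENNReal.ofReal c ≤ _ := hcg
      _ ≤ _ := lintegral_mono hpt
      _ = ∫⁻ h, E.indicator (weight l) h ∂(S.law ρ n) +
          ENNReal.ofReal (Real.exp (n * (G + ε / 2))) * ∫⁻ h, g h * weight l' h ∂(S.law ρ n) := by
        rw [lintegral_add_left ((measurable_weight hl).indicator hEm), lintegral_const_mul'
          _ _ ENNReal.ofReal_ne_top]
      _ ≤ ENNReal.ofReal (Real.exp (-(n * η))) + ENNReal.ofReal (Real.exp (n * (G + ε / 2))) *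
          ENNReal.ofReal (Real.exp (-(n * (G + ε)))) :=
        add_le_add ht (mul_le_mul_right hlt.le _)
      _ ≤ _ := by
        rw [← ENNReal.ofReal_mul (Real.exp_pos _).le, ← Real.exp_add]
        refine add_le_add (ENNReal.ofReal_le_ofReal hn1) (ENNReal.ofReal_le_ofReal ?_)
        refine le_trans (le_of_eq ?_) hn2
        congr 1
        ring
  rw [← ENNReal.ofReal_add (by positivity) (by positivity),
    ENNReal.ofReal_le_ofReal_iff (by positivity)] at h3
  linarith

/-! ### Non-adaptive strategies -/

/-- The POVM of each copy is drawn from `ν`. -/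
def Strategy.const {d : ℕ} (ν : Measure (POVM d)) [IsProbabilityMeasure ν] : Strategy d :=
  ⟨fun _ => Kernel.const _ ν, fun _ => inferInstance⟩

/-- The mixture of two POVMs with weights `t` and `1 - t`. -/
def twoPoint {d : ℕ} (t : ℝ) (M M' : POVM d) : Measure (POVM d) :=
  ENNReal.ofReal t • Measure.dirac M + (1 - ENNReal.ofReal t) • Measure.dirac M'

theorem isProbabilityMeasure_twoPoint {d : ℕ} {t : ℝ} (ht : t ≤ 1) (M M' : POVM d) :
    IsProbabilityMeasure (twoPoint t M M') := by
  constructor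
  simp only [twoPoint, Measure.coe_add, Measure.coe_smul, Pi.add_apply, Pi.smul_apply,
    measure_univ, smul_eq_mul, mul_one]
  exact add_tsub_cancel_of_le (by simpa using ht)

theorem measurable_tsum_outcome_exp {d : ℕ} (ρ : State d) {l : POVM d × ℕ → ℝ}
    (hl : Measurable l) :
    Measurable fun M => ∑' y, outcome ρ M y * ENNReal.ofReal (Real.exp (l (M, y))) :=
  Measurable.tsum fun y => (measurable_outcome ρ y).mul
    (hl.comp (measurable_id.prodMk measurable_const)).exp.ennreal_ofReal

/-- For a random POVM only the average drift must be at most `G`: the mixture is taken before `1 + x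
≤ exp x` is applied. -/
theorem stepBound_twoPoint {d : ℕ} (ρ : State d) {l D : POVM d × ℕ → ℝ} {K G t : ℝ}
    (ht0 : 0 ≤ t) (ht1 : t ≤ 1) (M M' : POVM d) [IsProbabilityMeasure (twoPoint t M M')]
    (hl : Measurable l) (hDm : Measurable D)
    (h1 : ∀ M, (mean ρ M fun y => Real.exp (l (M, y))) = 1) (hD : ∀ x, |D x| ≤ K)
    (hG : t * (mean ρ M fun y => Real.exp (l (M, y)) * D (M, y)) +
      (1 - t) * (mean ρ M' fun y => Real.exp (l (M', y)) * D (M', y)) ≤ G) :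
    StepBound (Strategy.const (twoPoint t M M')) ρ l D K G := by
  intro θ hθ hK k h
  change ∫⁻ M, _ ∂(twoPoint t M M') ≤ _
  have hm := measurable_tsum_outcome_exp ρ (l := fun x => l x + θ * D x)
    (hl.add (hDm.const_mul θ))
  have hnn : ∀ M, 0 ≤ mean ρ M fun y => Real.exp (l (M, y) + θ * D (M, y)) := fun M => by
    rw [← mean_const ρ M 0]
    exact mean_mono fun y => (Real.exp_pos _).le
  rw [twoPoint, lintegral_add_measure, lintegral_smul_measure, lintegral_smul_measure,
    lintegral_dirac' _ hm, lintegral_dirac' _ hm]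
  rw [tsum_outcome_mul fun y => (Real.exp_pos _).le, tsum_outcome_mul fun y => (Real.exp_pos _).le,
    smul_eq_mul, smul_eq_mul, ← ENNReal.ofReal_one, ← ENNReal.ofReal_sub _ ht0,
    ← ENNReal.ofReal_mul ht0, ← ENNReal.ofReal_mul (by linarith),
    ← ENNReal.ofReal_add (mul_nonneg ht0 (hnn M)) (mul_nonneg (by linarith) (hnn M'))]
  refine ENNReal.ofReal_le_ofReal ?_
  have e1 := mul_le_mul_of_nonneg_left
    (mean_exp_add_le (h1 M) (fun y => hD (M, y)) hθ hK) ht0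
  have e2 := mul_le_mul_of_nonneg_left
    (mean_exp_add_le (h1 M') (fun y => hD (M', y)) hθ hK) (sub_nonneg.2 ht1)
  have e3 := mul_le_mul_of_nonneg_left hG hθ
  have e4 := Real.add_one_le_exp (θ * G + θ ^ 2 * K ^ 2)
  linarith

theorem lintegral_weight_const_dirac_le {d : ℕ} (ρ : State d) {l : POVM d × ℕ → ℝ}
    (hl : Measurable l) (M : POVM d) (n : ℕ) :
    ∫⁻ h, weight l h ∂((Strategy.const (Measure.dirac M)).law ρ n) ≤
      ENNReal.ofReal ((mean ρ M fun y => Real.exp (l (M, y))) ^ n) := by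
  have hnn : 0 ≤ mean ρ M fun y => Real.exp (l (M, y)) := by
    rw [← mean_const ρ M 0]
    exact mean_mono fun y => (Real.exp_pos _).le
  rw [ENNReal.ofReal_pow hnn]
  refine lintegral_weight_le_pow _ ρ hl (fun k h => le_of_eq ?_) n
  change ∫⁻ M, _ ∂(Measure.dirac M) = _
  rw [lintegral_dirac' _ (measurable_tsum_outcome_exp ρ hl),
    tsum_outcome_mul fun y => (Real.exp_pos _).le]

theorem const_dirac_mem_detNonadaptive {d : ℕ} (M : POVM d) :
    Strategy.const (Measure.dirac M) ∈ detNonadaptive d := ⟨M, fun _ => rfl⟩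

theorem const_twoPoint_mem_twoPointNonadaptive {d : ℕ} {t : ℝ} (ht : t ≤ 1) (M M' : POVM d)
    [IsProbabilityMeasure (twoPoint t M M')] :
    Strategy.const (twoPoint t M M') ∈ twoPointNonadaptive d :=
  ⟨M, M', ENNReal.ofReal t, by simpa using ht, fun _ => rfl⟩

theorem twoPoint_one {d : ℕ} (M M' : POVM d) : twoPoint 1 M M' = Measure.dirac M := by
  simp [twoPoint]

/-! ### Rates -/

theorem log_ofReal_exp (x : ℝ) : ENNReal.log (ENNReal.ofReal (Real.exp x)) = (x : EReal) := by
  rw [ENNReal.log_ofReal_of_pos (Real.exp_pos x), Real.log_exp]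

theorem rate_le_coe_iff {n : ℕ} (hn : 0 < n) {p : ℝ≥0∞} {x : ℝ} :
    rate n p ≤ (x : EReal) ↔ ENNReal.ofReal (Real.exp (-(n * x))) ≤ p := by
  rw [rate, EReal.div_le_iff_le_mul (by exact_mod_cast hn) (EReal.natCast_ne_top n),
    EReal.neg_le, ← ENNReal.log_le_log_iff, log_ofReal_exp]
  push_cast
  rfl

theorem coe_le_rate_iff {n : ℕ} (hn : 0 < n) {p : ℝ≥0∞} {x : ℝ} :
    (x : EReal) ≤ rate n p ↔ p ≤ ENNReal.ofReal (Real.exp (-(n * x))) := by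
  rw [rate, EReal.le_div_iff_mul_le (by exact_mod_cast hn) (EReal.natCast_ne_top n),
    EReal.le_neg, ← ENNReal.log_le_log_iff, log_ofReal_exp]
  push_cast
  rw [mul_comm]

theorem eventually_le_exp_of_lt_liminf {p : ℕ → ℝ≥0∞} {x r : ℝ} (hx : x < r)
    (h : (r : EReal) ≤ liminf (fun n => rate n (p n)) atTop) :
    ∀ᶠ n : ℕ in atTop, p n ≤ ENNReal.ofReal (Real.exp (-(n * x))) := by
  have : (x : EReal) < liminf (fun n => rate n (p n)) atTop :=
    lt_of_lt_of_le (EReal.coe_lt_coe_iff.2 hx) h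
  filter_upwards [eventually_lt_of_lt_liminf this, eventually_gt_atTop 0] with n h1 h2
  exact (coe_le_rate_iff h2).1 h1.le

theorem coe_le_liminf_rate {p : ℕ → ℝ≥0∞} {x : ℝ}
    (h : ∀ᶠ n : ℕ in atTop, p n ≤ ENNReal.ofReal (Real.exp (-(n * x)))) :
    (x : EReal) ≤ liminf (fun n => rate n (p n)) atTop := by
  refine le_liminf_of_le (by isBoundedDefault) ?_
  filter_upwards [h, eventually_gt_atTop 0] with n h1 h2
  exact (coe_le_rate_iff h2).2 h1

theorem liminf_rate_le_coe {p : ℕ → ℝ≥0∞} {x : ℝ}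
    (h : ∃ᶠ n : ℕ in atTop, ENNReal.ofReal (Real.exp (-(n * x))) ≤ p n) :
    liminf (fun n => rate n (p n)) atTop ≤ (x : EReal) := by
  refine liminf_le_of_frequently_le ?_ (by isBoundedDefault)
  exact (h.and_eventually (eventually_gt_atTop 0)).mono fun n hn => (rate_le_coe_iff hn.2).2 hn.1

/-! ### Error probabilities of tests -/

section
variable {d n : ℕ} (T : Test d n)

theorem Test.measurable_one_sub : Measurable fun h => 1 - T.f h :=
  measurable_const.sub T.measurable_f

theorem Test.one_sub_le_one (h : Hist d n) : 1 - T.f h ≤ 1 := tsub_le_self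

theorem Test.lintegral_add {l : POVM d × ℕ → ℝ} (hl : Measurable l) (ρ : State d) :
    ∫⁻ h, T.f h * weight l h ∂(T.strategy.law ρ n) +
      ∫⁻ h, (1 - T.f h) * weight l h ∂(T.strategy.law ρ n) =
      ∫⁻ h, weight l h ∂(T.strategy.law ρ n) := by
  have hm : Measurable fun h => T.f h * weight l h := T.measurable_f.mul (measurable_weight hl)
  rw [← lintegral_add_left hm]
  refine lintegral_congr fun h => ?_
  rw [← add_mul, add_tsub_cancel_of_le (T.f_le_one h), one_mul]

theorem weight_zero (h : Hist d n) : weight (fun _ => (0 : ℝ)) h = 1 := by simp [weight]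

theorem Test.acceptAlt_eq (ρ : State d) :
    T.acceptAlt ρ = ∫⁻ h, T.f h * weight (fun _ => (0 : ℝ)) h ∂(T.strategy.law ρ n) := by
  simp [Test.acceptAlt, weight_zero]

theorem Test.acceptNull_eq (ρ : State d) :
    T.acceptNull ρ = ∫⁻ h, (1 - T.f h) * weight (fun _ => (0 : ℝ)) h ∂(T.strategy.law ρ n) := by
  simp [Test.acceptNull, weight_zero]

theorem Test.acceptAlt_add_acceptNull (ρ : State d) : T.acceptAlt ρ + T.acceptNull ρ = 1 := by
  rw [T.acceptAlt_eq, T.acceptNull_eq, T.lintegral_add measurable_const]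
  simp [weight_zero]

variable {ρ σ : State d} {L : ℝ}

theorem Comparable.acceptNull_eq (hc : Comparable ρ σ L) :
    T.acceptNull σ = ∫⁻ h, (1 - T.f h) * weight (llr ρ σ) h ∂(T.strategy.law ρ n) :=
  hc.lintegral_law _ _ T.measurable_one_sub

end

section
variable {d : ℕ} {ρ σ : State d} {L : ℝ}

/-! ### Converse bounds -/

/-- Change of measure from the law under `ρ` to that under `σ`. It needs only a fixed positive
probability of accepting the null for infinitely many `n`, which is why the strong converse comes at
no extra cost. -/
theorem Comparable.liminf_rate_le_of_liminf_lt_one (hc : Comparable ρ σ L) {D : ℝ}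
    (hD : ∀ M, klAlt ρ σ 0 M ≤ D) (T : ∀ n, Test d n)
    (hT : liminf (fun n => (T n).acceptAlt ρ) atTop < 1) :
    liminf (fun n => rate n ((T n).acceptNull σ)) atTop ≤ (D : EReal) := by
  obtain ⟨c, hc1, hc2⟩ := exists_between hT
  have hfreq := frequently_lt_of_liminf_lt (by isBoundedDefault) hc1
  have hcpos : 0 < (1 - c).toReal :=
    ENNReal.toReal_pos (tsub_pos_of_lt hc2).ne' (ENNReal.sub_ne_top ENNReal.one_ne_top)
  refine EReal.le_of_forall_lt_iff_le.1 fun z hz => ?_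
  have hε : 0 < z - D := sub_pos.2 (EReal.coe_lt_coe_iff.1 hz)
  refine liminf_rate_le_coe ((hfreq.and_eventually
    (eventually_exp_le_lintegral (d := d) hc.1 hε hcpos)).mono fun n hn => ?_)
  have hstep : StepBound (T n).strategy ρ (fun _ => 0) (fun x => 0 - llr ρ σ x) L D := by
    refine stepBound_of_mean_le _ ρ (fun M => ?_) (fun x => ?_) (fun M => ?_)
    · simp [mean_const]
    · simpa using hc.abs_llr_le x
    · refine le_trans (le_of_eq ?_) (hD M)
      simp [klAlt_zero]
  have := hn.2 (T n).strategy ρ _ _ D measurable_const (measurable_llr ρ σ) hstep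
    (fun h => 1 - (T n).f h) (T n).one_sub_le_one ?_
  · rw [hc.acceptNull_eq]
    convert this using 5
    ring
  · rw [← Test.acceptNull_eq, ENNReal.ofReal_toReal (ENNReal.sub_ne_top ENNReal.one_ne_top)]
    rw [tsub_le_iff_left, ← (T n).acceptAlt_add_acceptNull ρ]
    exact add_le_add_left hn.1.le _

/-- The tilting parameter at which the relative entropy with respect to `P^M_σ` is at most `r - τ`
and that with respect to `P^M_ρ` is nearly optimal. -/
theorem Comparable.exists_tilt_param (hc : Comparable ρ σ L) {r B τ : ℝ} (hτ0 : 0 < τ)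
    (hτ : τ ≤ r / 2)
    (hB : ∀ s ∈ Set.Ico (0 : ℝ) 1, ∀ M, (-s * r - logZ ρ σ s M) / (1 - s) ≤ B) (M : POVM d) :
    ∃ s ∈ Set.Icc (0 : ℝ) 1, klAlt ρ σ s M ≤ r - τ ∧ klNull ρ σ s M ≤ B + 4 * L * τ / r := by
  have hr : 0 < r := by linarith
  have hL := hc.1
  by_cases h0 : klAlt ρ σ 0 M ≤ r - τ
  · refine ⟨0, by simp, h0, ?_⟩
    have := hB 0 (by simp) M
    simp [logZ_zero] at this
    rw [klNull_zero]
    positivity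
  -- `klAlt` descends to `0` at `s = 1`, so it takes the value `r - τ`; there `klNull` is the
  -- Hoeffding objective at rate `r - τ`, and the bound on `1 - s` controls the error from replacing
  -- it by `r`.
  · obtain ⟨s, hs, hsr⟩ := intermediate_value_Icc' zero_le_one
      (hc.continuous_klAlt M).continuousOn
      (show r - τ ∈ Set.Icc (klAlt ρ σ 1 M) (klAlt ρ σ 0 M) by
        rw [hc.klAlt_one]
        exact ⟨by linarith, (not_le.1 h0).le⟩)
    simp only at hsr
    have h1 := hc.klAlt_le hs.2 M
    have hs1 : r / (4 * L) ≤ 1 - s := by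
      rw [div_le_iff₀ (by positivity)]
      linarith
    have hspos : 0 < 1 - s := lt_of_lt_of_le (by positivity) hs1
    refine ⟨s, hs, hsr.le, ?_⟩
    have h2 := hB s ⟨hs.1, by linarith⟩ M
    rw [klNull_eq (by linarith), hsr]
    have h3 : (-s * (r - τ) - logZ ρ σ s M) / (1 - s) =
        (-s * r - logZ ρ σ s M) / (1 - s) + s * τ / (1 - s) := by
      rw [← add_div]
      congr 1
      ring
    have h4 : s * τ / (1 - s) ≤ 4 * L * τ / r := by
      rw [div_le_div_iff₀ hspos hr]
      rw [div_le_iff₀ (by positivity)] at hs1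
      have h5 : τ * r ≤ τ * ((1 - s) * (4 * L)) := mul_le_mul_of_nonneg_left hs1 hτ0.le
      have h6 : s * (τ * r) ≤ 1 * (τ * r) := mul_le_mul_of_nonneg_right hs.2 (by positivity)
      linarith
    linarith

/-- A measurable choice of tilted distributions for all POVMs. -/
theorem Comparable.exists_measurable_tilt (hc : Comparable ρ σ L) {a b : ℝ}
    (h : ∀ M, ∃ s ∈ Set.Icc (0 : ℝ) 1, klAlt ρ σ s M < a ∧ klNull ρ σ s M < b) :
    ∃ l : POVM d × ℕ → ℝ, Measurable l ∧ (∀ M, (mean ρ M fun y => Real.exp (l (M, y))) = 1) ∧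
      (∀ x, |l x| ≤ 3 * L) ∧ (∀ x, |l x - llr ρ σ x| ≤ 3 * L) ∧
      (∀ M, (mean ρ M fun y => Real.exp (l (M, y)) * (l (M, y) - llr ρ σ (M, y))) ≤ a) ∧
      ∀ M, (mean ρ M fun y => Real.exp (l (M, y)) * l (M, y)) ≤ b := by
  classical
  -- The strict inequalities are open in `s`, so the first suitable member of a dense sequence gives
  -- a measurable selection.
  let q : ℕ → Set.Icc (0 : ℝ) 1 := TopologicalSpace.denseSeq _
  have hq : ∀ M, ∃ k, klAlt ρ σ (q k) M < a ∧ klNull ρ σ (q k) M < b := by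
    intro M
    obtain ⟨s, hs, h1, h2⟩ := h M
    obtain ⟨k, hk⟩ := (TopologicalSpace.denseRange_denseSeq (Set.Icc (0 : ℝ) 1)).exists_mem_open
      (s := {s : Set.Icc (0 : ℝ) 1 | klAlt ρ σ s M < a} ∩ {s | klNull ρ σ s M < b})
      ((isOpen_lt ((hc.continuous_klAlt M).comp continuous_subtype_val) continuous_const).inter
        (isOpen_lt ((hc.continuous_klNull M).comp continuous_subtype_val) continuous_const))
      ⟨⟨s, hs⟩, h1, h2⟩
    exact ⟨k, hk⟩
  have hm : Measurable fun M => Nat.find (hq M) := measurable_find hq fun k =>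
    (measurableSet_lt (measurable_klAlt ρ σ _) measurable_const).inter
      (measurableSet_lt (measurable_klNull ρ σ _) measurable_const)
  have habs : ∀ k, |(q k : ℝ)| ≤ 1 := fun k => abs_le.2 ⟨by linarith [(q k).2.1], (q k).2.2⟩
  have hL := hc.1
  refine ⟨fun x => tiltLog ρ σ (q (Nat.find (hq x.1))) x, ?_,
    fun M => hc.mean_exp_tiltLog (q (Nat.find (hq M))) M,
    fun x => ?_, fun x => ?_, fun M => ?_, fun M => ?_⟩
  · have : Measurable fun p : ℕ × (POVM d × ℕ) => tiltLog ρ σ (q p.1) p.2 :=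
      measurable_from_prod_countable_right fun k => measurable_tiltLog ρ σ (q k)
    exact this.comp ((hm.comp measurable_fst).prodMk measurable_id)
  · refine (hc.abs_tiltLog_le _ x).trans ?_
    have := habs (Nat.find (hq x.1))
    gcongr
    linarith
  · refine (hc.abs_tiltLog_sub_llr_le _ x).trans ?_
    have := habs (Nat.find (hq x.1))
    gcongr
    linarith
  · exact (hc.mean_tiltLog_sub_llr (q (Nat.find (hq M))) M).trans_le (Nat.find_spec (hq M)).1.le
  · exact (hc.mean_tiltLog (q (Nat.find (hq M))) M).trans_le (Nat.find_spec (hq M)).2.le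

theorem Comparable.exists_hoeffding_converse (hc : Comparable ρ σ L) {r B ε : ℝ} (hr : 0 < r)
    (hε : 0 < ε)
    (hB : ∀ s ∈ Set.Ico (0 : ℝ) 1, ∀ M, (-s * r - logZ ρ σ s M) / (1 - s) ≤ B) :
    ∃ δ : ℝ, 0 < δ ∧ ∀ᶠ n : ℕ in atTop, ∀ T : Test d n,
      T.acceptNull σ ≤ ENNReal.ofReal (Real.exp (-(n * (r - δ)))) →
      ENNReal.ofReal (Real.exp (-(n * (B + ε)))) ≤ T.acceptAlt ρ := by
  have hL := hc.1
  set τ := min (r / 2) (ε * r / (12 * L)) with hτdef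
  have hτ0 : 0 < τ := by positivity
  have hτ : 4 * L * τ / r ≤ ε / 3 := by
    have : τ ≤ ε * r / (12 * L) := min_le_right _ _
    rw [le_div_iff₀ (by positivity)] at this
    rw [div_le_iff₀ hr]
    linarith
  obtain ⟨l, hl, h1, hlb, hlb', ha, hb⟩ := hc.exists_measurable_tilt (a := r - 3 * τ / 4)
    (b := B + 2 * ε / 3) fun M => by
      obtain ⟨s, hs, h1, h2⟩ := hc.exists_tilt_param hτ0 (min_le_left _ _) hB M
      exact ⟨s, hs, by linarith, by linarith⟩
  -- The entropy budget is `r - 3 * τ / 4` and the change of measure costs `τ / 4`; their total `r -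
  -- τ / 2` is still below `r - τ / 4`, which gives the contradiction.
  refine ⟨τ / 4, by positivity, ?_⟩
  have h3L : 0 < 3 * L := by positivity
  filter_upwards [eventually_gt_atTop 0,
    eventually_exp_le_lintegral (d := d) (ε := τ / 4) h3L (by positivity) one_half_pos,
    eventually_exp_le_lintegral (d := d) (ε := ε / 3) h3L (by positivity) one_half_pos]
    with n hn hn1 hn2 T hT
  have hn' : (0 : ℝ) < n := by exact_mod_cast hn
  have hsum := T.lintegral_add hl ρ
  rw [lintegral_weight_eq_one _ ρ hl h1] at hsum
  have hnull : ∫⁻ h, (1 - T.f h) * weight l h ∂(T.strategy.law ρ n) < ENNReal.ofReal (1 / 2) := by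
    by_contra hcon
    have := hn1 T.strategy ρ l _ (r - 3 * τ / 4) hl (measurable_llr ρ σ)
      (stepBound_of_mean_le _ ρ h1 hlb' ha) _ T.one_sub_le_one (not_lt.1 hcon)
    rw [← hc.acceptNull_eq] at this
    have := this.trans hT
    rw [ENNReal.ofReal_le_ofReal_iff (Real.exp_pos _).le, Real.exp_le_exp, neg_le_neg_iff,
      mul_le_mul_iff_right₀ hn'] at this
    linarith
  have halt : ENNReal.ofReal (1 / 2) ≤ ∫⁻ h, T.f h * weight l h ∂(T.strategy.law ρ n) := by
    by_contra hcon
    have := ENNReal.add_lt_add (not_le.1 hcon) hnull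
    rw [hsum, ← ENNReal.ofReal_add (by norm_num) (by norm_num)] at this
    norm_num at this
  have := hn2 T.strategy ρ l (fun _ => 0) (B + 2 * ε / 3) hl measurable_const
    (stepBound_of_mean_le _ ρ h1 (by simpa using hlb) (by simpa using hb)) _ T.f_le_one halt
  rw [T.acceptAlt_eq]
  convert this using 5
  ring

/-- The bound on the success probability behind the strong converse. -/
theorem Comparable.acceptNull_le (hc : Comparable ρ σ L) {n : ℕ} (T : Test d n) {s v x : ℝ}
    (hs : s ≤ 0) (hv : ∀ M, logZ ρ σ s M ≤ v)
    (hx : T.acceptNull σ ≤ ENNReal.ofReal (Real.exp (-(n * x)))) :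
    T.acceptNull ρ ≤ ENNReal.ofReal (2 * Real.exp (-(n * ((-s * x - v) / (1 - s))))) := by
  -- This threshold equalizes the exponents of the two error terms below.
  set lam := (x + v) / (1 - s) with hlam
  have hs1 : 0 < 1 - s := by linarith
  have hl := measurable_llr ρ σ
  have hpt : ∀ h : Hist d n, 1 - T.f h ≤
      ENNReal.ofReal (Real.exp (n * lam)) * ((1 - T.f h) * weight (llr ρ σ) h) +
      ENNReal.ofReal (Real.exp (n * lam * s)) * weight (fun y => s * llr ρ σ y) h := by
    intro h
    rw [mul_left_comm, weight, weight, ← Finset.mul_sum, ← ENNReal.ofReal_mul (Real.exp_pos _).le,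
      ← Real.exp_add, ← ENNReal.ofReal_mul (Real.exp_pos _).le, ← Real.exp_add]
    generalize ∑ k, llr ρ σ (h k) = X
    -- Either the likelihood factor of the first term is at least `1`, or, since `s ≤ 0`, the whole
    -- second term is.
    rcases le_total 0 (n * lam + X) with h0 | h0
    · refine le_add_right (le_mul_of_one_le_right zero_le ?_)
      simpa using h0
    · refine le_add_left ((T.one_sub_le_one h).trans ?_)
      simp only [ENNReal.one_le_ofReal, Real.one_le_exp_iff]
      nlinarith
  have hm : Measurable fun h : Hist d n => ENNReal.ofReal (Real.exp (n * lam)) *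
      ((1 - T.f h) * weight (llr ρ σ) h) :=
    (T.measurable_one_sub.mul (measurable_weight hl)).const_mul _
  have hZ : ∫⁻ h, weight (fun y => s * llr ρ σ y) h ∂(T.strategy.law ρ n) ≤
      ENNReal.ofReal (Real.exp v) ^ n := by
    refine lintegral_weight_le_pow _ ρ (hl.const_mul s) (fun k h => ?_) n
    have : ∀ M, ∑' y, outcome ρ M y * ENNReal.ofReal (Real.exp (s * llr ρ σ (M, y))) ≤
        ENNReal.ofReal (Real.exp v) := fun M => by
      rw [tsum_outcome_mul fun y => (Real.exp_pos _).le, ← partZ, ← hc.exp_logZ]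
      exact ENNReal.ofReal_le_ofReal (Real.exp_le_exp.2 (hv M))
    refine (lintegral_mono this).trans ?_
    simp
  calc T.acceptNull ρ ≤ _ := lintegral_mono hpt
    _ = ENNReal.ofReal (Real.exp (n * lam)) * T.acceptNull σ +
        ENNReal.ofReal (Real.exp (n * lam * s)) *
          ∫⁻ h, weight (fun y => s * llr ρ σ y) h ∂(T.strategy.law ρ n) := by
      rw [lintegral_add_left hm, lintegral_const_mul' _ _ ENNReal.ofReal_ne_top,
        lintegral_const_mul' _ _ ENNReal.ofReal_ne_top, hc.acceptNull_eq]
    _ ≤ ENNReal.ofReal (Real.exp (n * lam)) * ENNReal.ofReal (Real.exp (-(n * x))) +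
        ENNReal.ofReal (Real.exp (n * lam * s)) * ENNReal.ofReal (Real.exp v) ^ n := by
      gcongr
    _ = _ := by
      rw [← ENNReal.ofReal_pow (Real.exp_pos _).le, ← Real.exp_nat_mul,
        ← ENNReal.ofReal_mul (Real.exp_pos _).le, ← ENNReal.ofReal_mul (Real.exp_pos _).le,
        ← Real.exp_add, ← Real.exp_add, ← ENNReal.ofReal_add (Real.exp_pos _).le
        (Real.exp_pos _).le, two_mul]
      have e1 : n * lam + -(n * x) = -(n * ((-s * x - v) / (1 - s))) := by
        rw [hlam]
        field_simp
        ring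
      have e2 : n * lam * s + n * v = -(n * ((-s * x - v) / (1 - s))) := by
        rw [hlam]
        field_simp
        ring
      rw [e1, e2]

theorem Comparable.tilt_le_liminf_rate (hc : Comparable ρ σ L) (T : ∀ n, Test d n) {r s v : ℝ}
    (hs : s ≤ 0) (hv : ∀ M, logZ ρ σ s M ≤ v)
    (hr : (r : EReal) ≤ liminf (fun n => rate n ((T n).acceptNull σ)) atTop) :
    (((-s * r - v) / (1 - s) : ℝ) : EReal) ≤
      liminf (fun n => rate n ((T n).acceptNull ρ)) atTop := by
  refine EReal.ge_of_forall_gt_iff_ge.1 fun z hz => ?_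
  have hs1 : 0 < 1 - s := by linarith
  set w := (-s * r - v) / (1 - s) with hw
  -- One half of the gap pays for weakening `r` to `r - δ`, the other absorbs the factor `2`.
  set δ := (w - z) / 2 with hδ
  have hδ0 : 0 < δ := half_pos (sub_pos.2 (EReal.coe_lt_coe_iff.1 hz))
  refine coe_le_liminf_rate ?_
  filter_upwards [eventually_le_exp_of_lt_liminf (sub_lt_self r hδ0) hr,
    eventually_exp_neg_mul_le hδ0 (c := 1 / 2) (by norm_num)] with n hn hn2
  refine (hc.acceptNull_le (T n) hs hv hn).trans (ENNReal.ofReal_le_ofReal ?_)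
  have h1 : w - δ ≤ (-s * (r - δ) - v) / (1 - s) := by
    rw [le_div_iff₀ hs1, sub_mul, hw, div_mul_cancel₀ _ hs1.ne']
    nlinarith
  calc 2 * Real.exp (-(n * ((-s * (r - δ) - v) / (1 - s))))
      ≤ 2 * Real.exp (-(n * (w - δ))) := by gcongr
    _ = 2 * Real.exp (-(n * δ)) * Real.exp (-(n * z)) := by
      rw [mul_assoc, ← Real.exp_add]
      congr 2
      rw [hδ]
      ring
    _ ≤ 1 * Real.exp (-(n * z)) := by
      gcongr
      linarith
    _ = _ := one_mul _

end

/-! ### Likelihood ratio tests -/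

/-- The data for which the sum of `D` is at least `n a`. -/
def sumGe {d : ℕ} (D : POVM d × ℕ → ℝ) (a : ℝ) (n : ℕ) : Set (Hist d n) :=
  {h | n * a ≤ ∑ k, D (h k)}

theorem measurableSet_sumGe {d : ℕ} {D : POVM d × ℕ → ℝ} (hD : Measurable D) (a : ℝ) (n : ℕ) :
    MeasurableSet (sumGe D a n) :=
  measurableSet_le measurable_const (measurable_sum_hist hD)

/-- The test that decides for the null hypothesis with probability `exp (-n c)` if the sum of `D` is
at least `n a`, and else decides for the alternative. -/
def thresholdTest {d : ℕ} (S : Strategy d) {D : POVM d × ℕ → ℝ} (hD : Measurable D) (a c : ℝ)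
    (n : ℕ) : Test d n where
  strategy := S
  f h := 1 - (sumGe D a n).indicator (fun _ => ENNReal.ofReal (Real.exp (-(n * c)))) h
  measurable_f := measurable_const.sub (measurable_const.indicator (measurableSet_sumGe hD a n))
  f_le_one _ := tsub_le_self

section
variable {d : ℕ} (S : Strategy d) {D : POVM d × ℕ → ℝ} (hD : Measurable D) (a : ℝ) {c : ℝ} (n : ℕ)

theorem one_sub_thresholdTest (hc : 0 ≤ c) (h : Hist d n) :
    1 - (thresholdTest S hD a c n).f h =
      (sumGe D a n).indicator (fun _ => ENNReal.ofReal (Real.exp (-(n * c)))) h := by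
  refine ENNReal.sub_sub_cancel ENNReal.one_ne_top ?_
  refine Set.indicator_apply_le' (fun _ => ?_) fun _ => zero_le
  rw [ENNReal.ofReal_le_one, Real.exp_le_one_iff]
  exact neg_nonpos.2 (by positivity)

theorem lintegral_one_sub_thresholdTest (hc : 0 ≤ c) (l : POVM d × ℕ → ℝ) (ρ : State d) :
    ∫⁻ h, (1 - (thresholdTest S hD a c n).f h) * weight l h ∂(S.law ρ n) =
      ENNReal.ofReal (Real.exp (-(n * c))) *
        ∫⁻ h, (sumGe D a n).indicator (weight l) h ∂(S.law ρ n) := by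
  rw [← lintegral_const_mul' _ _ ENNReal.ofReal_ne_top]
  refine lintegral_congr fun h => ?_
  rw [one_sub_thresholdTest S hD a n hc]
  by_cases hh : h ∈ sumGe D a n <;> simp [hh]

theorem acceptAlt_thresholdTest_zero (ρ : State d) :
    (thresholdTest S hD a 0 n).acceptAlt ρ =
      ∫⁻ h, (sumGe D a n)ᶜ.indicator (weight fun _ => 0) h ∂(S.law ρ n) := by
  refine lintegral_congr fun h => ?_
  by_cases hh : h ∈ sumGe D a n <;> simp [hh, thresholdTest, weight_zero]

end

theorem lintegral_indicator_weight_le {d n : ℕ} (S : Strategy d) (ρ : State d)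
    {l l' : POVM d × ℕ → ℝ} (hl' : Measurable l') (E : Set (Hist d n)) {x y : ℝ}
    (hE : ∀ h ∈ E, ∑ k, l (h k) ≤ ∑ k, l' (h k) + n * x)
    (hy : ∫⁻ h, weight l' h ∂(S.law ρ n) ≤ ENNReal.ofReal (Real.exp (n * y))) :
    ∫⁻ h, E.indicator (weight l) h ∂(S.law ρ n) ≤ ENNReal.ofReal (Real.exp (n * (x + y))) := by
  calc ∫⁻ h, E.indicator (weight l) h ∂(S.law ρ n)
      ≤ ∫⁻ h, ENNReal.ofReal (Real.exp (n * x)) * weight l' h ∂(S.law ρ n) := by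
        refine lintegral_mono fun h => Set.indicator_apply_le' (fun hh => ?_) fun _ => zero_le
        rw [weight, weight, ← ENNReal.ofReal_mul (Real.exp_pos _).le, ← Real.exp_add]
        exact ENNReal.ofReal_le_ofReal (Real.exp_le_exp.2 (by linarith [hE h hh]))
    _ = ENNReal.ofReal (Real.exp (n * x)) * ∫⁻ h, weight l' h ∂(S.law ρ n) :=
        lintegral_const_mul _ (measurable_weight hl')
    _ ≤ ENNReal.ofReal (Real.exp (n * x)) * ENNReal.ofReal (Real.exp (n * y)) := by gcongr
    _ = _ := by
        rw [← ENNReal.ofReal_mul (Real.exp_pos _).le, ← Real.exp_add, mul_add]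

section
variable {d : ℕ} {ρ σ : State d} {L : ℝ}

theorem tiltLog_zero : tiltLog ρ σ 0 = fun _ => 0 := by
  ext x
  simp [tiltLog, logZ_zero]

/-- With one fixed POVM, the likelihood ratio test reaches the exponents of the Chernoff bound. -/
theorem Comparable.exists_thresholdTest (hc : Comparable ρ σ L) (M : POVM d) {s : ℝ}
    (hs : s ∈ Set.Icc (0 : ℝ) 1) (lam : ℝ) (n : ℕ) :
    ∃ T : Test d n, T.strategy ∈ detNonadaptive d ∧
      T.acceptNull σ ≤ ENNReal.ofReal (Real.exp (n * (-(1 - s) * lam + logZ ρ σ s M))) ∧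
      T.acceptAlt ρ ≤ ENNReal.ofReal (Real.exp (n * (s * lam + logZ ρ σ s M))) := by
  have hl := measurable_llr ρ σ
  have hl' : Measurable fun x => s * llr ρ σ x := hl.const_mul s
  have hD : Measurable fun x => -llr ρ σ x := hl.neg
  have hZ : ∫⁻ h, weight (fun x => s * llr ρ σ x) h
      ∂((Strategy.const (Measure.dirac M)).law ρ n) ≤
      ENNReal.ofReal (Real.exp (n * logZ ρ σ s M)) := by
    refine (lintegral_weight_const_dirac_le ρ hl' M n).trans (le_of_eq ?_)
    rw [Real.exp_nat_mul, hc.exp_logZ, partZ]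
  refine ⟨thresholdTest (Strategy.const (Measure.dirac M)) hD lam 0 n,
    const_dirac_mem_detNonadaptive M, ?_, ?_⟩
  · rw [hc.acceptNull_eq]
    refine (lintegral_one_sub_thresholdTest _ hD lam n le_rfl _ ρ).trans_le ?_
    simp only [mul_zero, neg_zero, Real.exp_zero, ENNReal.ofReal_one, one_mul]
    refine lintegral_indicator_weight_le _ ρ hl' _ (fun h hh => ?_) hZ
    have hh' : n * lam ≤ ∑ k, -llr ρ σ (h k) := hh
    rw [Finset.sum_neg_distrib] at hh'
    rw [← Finset.mul_sum]
    have := mul_le_mul_of_nonneg_left hh' (sub_nonneg.2 hs.2)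
    linarith
  · rw [acceptAlt_thresholdTest_zero]
    refine lintegral_indicator_weight_le _ ρ hl' _ (fun h hh => ?_) hZ
    have hh' : ∑ k, -llr ρ σ (h k) < n * lam := not_le.1 hh
    rw [Finset.sum_neg_distrib] at hh'
    rw [← Finset.mul_sum, Finset.sum_const_zero]
    have := mul_le_mul_of_nonneg_left hh'.le hs.1
    linarith

/-- Under the tilted distributions the typical data have the normalized log-likelihood ratio
`klAlt`. -/
theorem Comparable.exists_lintegral_compl_sumGe_le (hc : Comparable ρ σ L) (s : ℝ) {t : ℝ}
    (ht0 : 0 ≤ t) (ht1 : t ≤ 1) (M M' : POVM d) [IsProbabilityMeasure (twoPoint t M M')] {a : ℝ}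
    (ha : a < t * klAlt ρ σ s M + (1 - t) * klAlt ρ σ s M') :
    ∃ η : ℝ, 0 < η ∧ ∀ n : ℕ,
      ∫⁻ h, (sumGe (fun x => tiltLog ρ σ s x - llr ρ σ x) a n)ᶜ.indicator (weight (tiltLog ρ σ s)) h
        ∂((Strategy.const (twoPoint t M M')).law ρ n) ≤ ENNReal.ofReal (Real.exp (-(n * η))) := by
  have hL := hc.1
  have hm := measurable_tiltLog ρ σ s
  have hl := measurable_llr ρ σ
  set F := t * klAlt ρ σ s M + (1 - t) * klAlt ρ σ s M' with hF
  have hK : 0 < (2 * |s| + 1) * L := by positivity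
  obtain ⟨η, hη, htail⟩ := exists_tail_bound (d := d) hK (sub_pos.2 ha)
  refine ⟨η, hη, fun n => ?_⟩
  have hneg : ∀ M, (mean ρ M fun y => Real.exp (tiltLog ρ σ s (M, y)) *
      -(tiltLog ρ σ s (M, y) - llr ρ σ (M, y))) = -klAlt ρ σ s M := by
    intro M
    rw [← hc.mean_tiltLog_sub_llr, ← neg_one_mul, ← mean_const_mul]
    congr 1
    ext y
    ring
  have hstep : StepBound (Strategy.const (twoPoint t M M')) ρ (tiltLog ρ σ s)
      (fun x => -(tiltLog ρ σ s x - llr ρ σ x)) ((2 * |s| + 1) * L) (-F) := by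
    refine stepBound_twoPoint ρ ht0 ht1 M M' hm (hm.sub hl).neg (hc.mean_exp_tiltLog s)
      (fun x => ?_) (le_of_eq ?_)
    · rw [abs_neg]
      exact hc.abs_tiltLog_sub_llr_le s x
    · rw [hneg, hneg, hF]
      ring
  refine le_trans (lintegral_mono fun h => ?_) (htail _ ρ _ _ (-F) hm (hm.sub hl).neg hstep n)
  refine Set.indicator_le_indicator_of_subset (fun h hh => ?_) (fun _ => zero_le) h
  have hh' : ∑ k, (tiltLog ρ σ s (h k) - llr ρ σ (h k)) < n * a := not_le.1 hh
  change n * (-F + (F - a)) ≤ ∑ k, -(tiltLog ρ σ s (h k) - llr ρ σ (h k))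
  rw [Finset.sum_neg_distrib]
  linarith

/-- On this region the density of `σ` is at most `exp (-n a)` times the tilted density, which
integrates to one. -/
theorem Comparable.lintegral_sumGe_le (hc : Comparable ρ σ L) (S : Strategy d) (s a : ℝ) (n : ℕ) :
    ∫⁻ h, (sumGe (fun x => tiltLog ρ σ s x - llr ρ σ x) a n).indicator (weight (llr ρ σ)) h
      ∂(S.law ρ n) ≤ ENNReal.ofReal (Real.exp (-(n * a))) := by
  refine (lintegral_indicator_weight_le S ρ (measurable_tiltLog ρ σ s) _ (x := -a) (y := 0)
    (fun h hh => ?_) ?_).trans (le_of_eq ?_)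
  · have hh' : n * a ≤ ∑ k, (tiltLog ρ σ s (h k) - llr ρ σ (h k)) := hh
    rw [Finset.sum_sub_distrib] at hh'
    linarith
  · rw [lintegral_weight_eq_one S ρ (measurable_tiltLog ρ σ s) (hc.mean_exp_tiltLog s)]
    simp
  · congr 2
    ring

/-! ### The Stein bound -/

theorem Comparable.klAlt_zero_le_stein (hc : Comparable ρ σ L) (M : POVM d) :
    (klAlt ρ σ 0 M : EReal) ≤ stein (detNonadaptive d) ρ σ := by
  refine EReal.ge_of_forall_gt_iff_ge.1 fun a ha => ?_
  rw [EReal.coe_lt_coe_iff] at ha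
  have hD : Measurable fun x => tiltLog ρ σ 0 x - llr ρ σ x :=
    (measurable_tiltLog ρ σ 0).sub (measurable_llr ρ σ)
  have := isProbabilityMeasure_twoPoint (d := d) le_rfl M M
  -- A degenerate mixture: one fixed POVM, in the form that the two-point concentration bound
  -- accepts.
  let S := Strategy.const (twoPoint 1 M M)
  obtain ⟨η, hη, htail⟩ := hc.exists_lintegral_compl_sumGe_le 0 zero_le_one le_rfl M M
    (a := a) (by simpa using ha)
  refine le_trans ?_ (le_sSup ⟨thresholdTest S hD a 0, fun n => ⟨M, fun k => ?_⟩, ?_, rfl⟩)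
  · refine coe_le_liminf_rate (Eventually.of_forall fun n => ?_)
    rw [hc.acceptNull_eq]
    refine (lintegral_one_sub_thresholdTest S hD a n le_rfl _ ρ).trans_le ?_
    simp only [mul_zero, neg_zero, Real.exp_zero, ENNReal.ofReal_one, one_mul]
    exact hc.lintegral_sumGe_le S 0 a n
  · change Kernel.const _ (twoPoint 1 M M) = _
    rw [twoPoint_one]
  · have h0 : Tendsto (fun n : ℕ => ENNReal.ofReal (Real.exp (-(n * η)))) atTop (𝓝 0) := by
      rw [← ENNReal.ofReal_zero]
      exact ENNReal.tendsto_ofReal (Real.tendsto_exp_neg_atTop_nhds_zero.comp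
        (tendsto_natCast_atTop_atTop.atTop_mul_const hη))
    refine tendsto_of_tendsto_of_tendsto_of_le_of_le tendsto_const_nhds h0 (fun _ => zero_le)
      fun n => ?_
    simp only [acceptAlt_thresholdTest_zero]
    have := htail n
    simp only [tiltLog_zero] at this ⊢
    exact this

theorem stein_mono {𝒞 𝒞' : Set (Strategy d)} (h : 𝒞 ⊆ 𝒞') : stein 𝒞 ρ σ ≤ stein 𝒞' ρ σ :=
  sSup_le_sSup fun _ ⟨T, h1, h2⟩ => ⟨T, fun n => h (h1 n), h2⟩

theorem stein_le_steinStrong (𝒞 : Set (Strategy d)) : stein 𝒞 ρ σ ≤ steinStrong 𝒞 ρ σ :=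
  sSup_le_sSup fun _ ⟨T, h1, h2, h3⟩ => ⟨T, h1, by rw [h2.liminf_eq]; exact zero_lt_one, h3⟩

theorem steinStrong_mono {𝒞 𝒞' : Set (Strategy d)} (h : 𝒞 ⊆ 𝒞') :
    steinStrong 𝒞 ρ σ ≤ steinStrong 𝒞' ρ σ :=
  sSup_le_sSup fun _ ⟨T, h1, h2⟩ => ⟨T, fun n => h (h1 n), h2⟩

theorem Comparable.stein_bound (hc : Comparable ρ σ L) :
    IsGreatest (Set.range (measuredKL ρ σ)) (stein (adaptive d) ρ σ) ∧
      steinStrong (adaptive d) ρ σ = stein (adaptive d) ρ σ ∧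
      stein (detNonadaptive d) ρ σ = stein (adaptive d) ρ σ ∧
      steinStrong (detNonadaptive d) ρ σ = stein (adaptive d) ρ σ := by
  obtain ⟨M₀, hM₀⟩ := hc.exists_max_klAlt_zero
  have hsub : detNonadaptive d ⊆ adaptive d := Set.subset_univ _
  have h1 := hc.klAlt_zero_le_stein M₀
  have h2 : steinStrong (adaptive d) ρ σ ≤ (klAlt ρ σ 0 M₀ : EReal) := by
    refine sSup_le ?_
    rintro e ⟨T, -, hT, rfl⟩
    exact hc.liminf_rate_le_of_liminf_lt_one hM₀ T hT
  have h3 := stein_mono (ρ := ρ) (σ := σ) hsub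
  have h4 := steinStrong_mono (ρ := ρ) (σ := σ) hsub
  have h5 := stein_le_steinStrong (ρ := ρ) (σ := σ) (adaptive d)
  have h6 := stein_le_steinStrong (ρ := ρ) (σ := σ) (detNonadaptive d)
  have e1 : stein (adaptive d) ρ σ = (klAlt ρ σ 0 M₀ : EReal) :=
    le_antisymm (h5.trans h2) (h1.trans h3)
  refine ⟨⟨⟨M₀, by rw [e1, hc.measuredKL_eq]⟩, ?_⟩, ?_, ?_, ?_⟩
  · rintro _ ⟨M, rfl⟩
    rw [e1, hc.measuredKL_eq, EReal.coe_le_coe_iff]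
    exact hM₀ M
  · exact le_antisymm (h2.trans e1.ge) h5
  · exact le_antisymm h3 (e1.le.trans h1)
  · exact le_antisymm (h4.trans (h2.trans e1.ge)) (e1.le.trans (h1.trans h6))

/-! ### The Chernoff bound -/

theorem minErrorSum_anti {𝒞 𝒞' : Set (Strategy d)} (h : 𝒞 ⊆ 𝒞') (n : ℕ) :
    minErrorSum 𝒞' ρ σ n ≤ minErrorSum 𝒞 ρ σ n :=
  iInf_mono fun _ => iInf_mono' fun hT => ⟨h hT, le_rfl⟩

theorem rate_anti {n : ℕ} {p q : ℝ≥0∞} (h : p ≤ q) : rate n q ≤ rate n p :=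
  EReal.div_le_div_right_of_nonneg (Nat.cast_nonneg' n)
    (EReal.neg_le_neg_iff.2 (ENNReal.log_le_log_iff.2 h))

theorem Comparable.chernoff_bound (hc : Comparable ρ σ L) :
    ∃ C : EReal,
      IsGreatest (Set.range fun M : POVM d => -⨅ s ∈ Set.Icc (0 : ℝ) 1, measuredPhi s ρ σ M) C ∧
      Tendsto (fun n => rate n (minErrorSum (adaptive d) ρ σ n)) atTop (𝓝 C) ∧
      Tendsto (fun n => rate n (minErrorSum (detNonadaptive d) ρ σ n)) atTop (𝓝 C) := by
  obtain ⟨s₀, hs₀, M₀, hmax⟩ := hc.exists_max_comp_logZ isCompact_Icc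
    (Set.nonempty_Icc.2 (zero_le_one (α := ℝ))) (g := fun _ v => -v)
    (continuous_snd.neg.continuousOn) (fun s _ => fun v w h => neg_le_neg h)
  set C := -logZ ρ σ s₀ M₀ with hC
  have hC0 : 0 ≤ C := by
    have := hmax 0 (by simp) M₀
    simpa [logZ_zero] using this
  have hmono : ∀ n, rate n (minErrorSum (detNonadaptive d) ρ σ n) ≤
      rate n (minErrorSum (adaptive d) ρ σ n) := fun n =>
    rate_anti (minErrorSum_anti (Set.subset_univ _) n)
  have hlow : ∀ a < (C : EReal), ∀ᶠ n in atTop,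
      a < rate n (minErrorSum (detNonadaptive d) ρ σ n) := by
    intro a ha
    obtain ⟨z, haz, hz⟩ := EReal.lt_iff_exists_real_btwn.1 ha
    have hε : 0 < C - z := sub_pos.2 (EReal.coe_lt_coe_iff.1 hz)
    filter_upwards [eventually_gt_atTop 0, eventually_exp_neg_mul_le hε one_half_pos] with n hn hn2
    refine haz.trans_le ((coe_le_rate_iff hn).2 ?_)
    -- At threshold `0` both error bounds have the same exponent `φ(s₀)`.
    obtain ⟨T, hT, h1, h2⟩ := hc.exists_thresholdTest M₀ hs₀ 0 n
    refine (iInf₂_le T hT).trans ((add_le_add h2 h1).trans ?_)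
    rw [← ENNReal.ofReal_add (Real.exp_pos _).le (Real.exp_pos _).le]
    refine ENNReal.ofReal_le_ofReal ?_
    have e : Real.exp (n * logZ ρ σ s₀ M₀) = Real.exp (-(n * (C - z))) * Real.exp (-(n * z)) := by
      rw [← Real.exp_add]
      congr 1
      rw [hC]
      ring
    simp only [mul_zero, zero_add, e]
    have := mul_le_mul_of_nonneg_right hn2 (Real.exp_pos (-(n * z))).le
    linarith
  have hup : ∀ a > (C : EReal), ∀ᶠ n in atTop,
      rate n (minErrorSum (adaptive d) ρ σ n) < a := by
    intro a ha
    obtain ⟨z, hz, haz⟩ := EReal.lt_iff_exists_real_btwn.1 ha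
    have hz' : C < z := EReal.coe_lt_coe_iff.1 hz
    -- For `z > C` the Hoeffding objective at rate `z` is at most `(C - s z) / (1 - s) ≤ C`; hence
    -- one of the two errors is at least about `exp (-n z)`.
    obtain ⟨δ, hδ, hev⟩ := hc.exists_hoeffding_converse (r := z) (B := C) (ε := z - C)
      (by linarith) (by linarith) (fun s hs M => by
        rw [div_le_iff₀ (by linarith [hs.2])]
        have := hmax s ⟨hs.1, hs.2.le⟩ M
        have := mul_le_mul_of_nonneg_left hz'.le hs.1
        linarith)
    filter_upwards [eventually_gt_atTop 0, hev] with n hn hev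
    refine ((rate_le_coe_iff hn).2 (le_iInf₂ fun T _ => ?_)).trans_lt haz
    rcases le_total (T.acceptNull σ) (ENNReal.ofReal (Real.exp (-(n * (z - δ))))) with h | h
    · have := hev T h
      rw [add_sub_cancel] at this
      exact le_add_right this
    · refine le_add_left (le_trans (ENNReal.ofReal_le_ofReal (Real.exp_le_exp.2 ?_)) h)
      have : (n : ℝ) * (z - δ) ≤ n * z := by gcongr; linarith
      linarith
  refine ⟨C, ⟨⟨M₀, ?_⟩, ?_⟩, ?_, ?_⟩
  · simp only [hc.measuredPhi_eq, hC, EReal.coe_neg]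
    congr 1
    refine le_antisymm (iInf₂_le s₀ hs₀) (le_iInf₂ fun s hs => EReal.coe_le_coe_iff.2 ?_)
    linarith [hmax s hs M₀]
  · rintro _ ⟨M, rfl⟩
    simp only [hc.measuredPhi_eq, hC, EReal.coe_neg]
    refine EReal.neg_le_neg_iff.2 (le_iInf₂ fun s hs => EReal.coe_le_coe_iff.2 ?_)
    linarith [hmax s hs M]
  · exact tendsto_order.2 ⟨fun a ha => (hlow a ha).mono fun n hn => hn.trans_le (hmono n), hup⟩
  · exact tendsto_order.2 ⟨hlow, fun a ha => (hup a ha).mono fun n hn => (hmono n).trans_lt hn⟩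

/-! ### The Hoeffding bound -/

/-- For `s ≥ L / (r + L)` one has `-φ(s) ≤ (1 - s) L ≤ s r`, so the objective is nonpositive, while
it vanishes at `s = 0`. The supremum is thus a maximum over a compact interval. -/
theorem Comparable.exists_max_tilt (hc : Comparable ρ σ L) {r : ℝ} (hr : 0 < r) :
    ∃ s₀ ∈ Set.Ico (0 : ℝ) 1, ∃ M₀ : POVM d, ∀ s ∈ Set.Ico (0 : ℝ) 1, ∀ M,
      (-s * r - logZ ρ σ s M) / (1 - s) ≤ (-s₀ * r - logZ ρ σ s₀ M₀) / (1 - s₀) := by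
  have hL := hc.1
  have hs1 : L / (r + L) < 1 := by
    rw [div_lt_one (by positivity)]
    linarith
  have hlt : ∀ s ∈ Set.Icc (0 : ℝ) (L / (r + L)), 0 < 1 - s := fun s hs => by
    linarith [hs.2]
  obtain ⟨s₀, hs₀, M₀, hmax⟩ := hc.exists_max_comp_logZ
    (isCompact_Icc (a := (0 : ℝ)) (b := L / (r + L)))
    (Set.nonempty_Icc.2 (by positivity)) (g := fun s v => (-s * r - v) / (1 - s))
    (ContinuousOn.div (Continuous.continuousOn (by fun_prop))
      (Continuous.continuousOn (by fun_prop)) fun x hx => (hlt x.1 hx.1).ne')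
    (fun s hs v w h => div_le_div_of_nonneg_right (by linarith) (hlt s hs).le)
  refine ⟨s₀, ⟨hs₀.1, by linarith [hlt s₀ hs₀]⟩, M₀, fun s hs M => ?_⟩
  rcases le_total s (L / (r + L)) with h | h
  · exact hmax s ⟨hs.1, h⟩ M
  · have h0 := hmax 0 ⟨le_rfl, by positivity⟩ M
    simp only [neg_zero, zero_mul, logZ_zero, sub_zero, zero_div] at h0
    refine le_trans (div_nonpos_of_nonpos_of_nonneg ?_ (by linarith [hs.2])) h0
    rw [div_le_iff₀ (by positivity)] at h
    linarith [hc.neg_logZ_le hs.2.le M]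

theorem hoeffding_mono {𝒞 𝒞' : Set (Strategy d)} (h : 𝒞 ⊆ 𝒞') (r : ℝ) :
    hoeffding 𝒞 r ρ σ ≤ hoeffding 𝒞' r ρ σ :=
  sSup_le_sSup fun _ ⟨T, h1, h2⟩ => ⟨T, fun n => h (h1 n), h2⟩

theorem Comparable.hoeffding_bound (hc : Comparable ρ σ L) {r : ℝ} (hr : 0 < r) :
    IsGreatest
        (Set.range fun M : POVM d => ⨆ s ∈ Set.Ico (0 : ℝ) 1, tilt r s (measuredPhi s ρ σ M))
        (hoeffding (adaptive d) r ρ σ) ∧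
      hoeffding (detNonadaptive d) r ρ σ = hoeffding (adaptive d) r ρ σ := by
  obtain ⟨s₀, hs₀, M₀, hmax⟩ := hc.exists_max_tilt hr
  set B := (-s₀ * r - logZ ρ σ s₀ M₀) / (1 - s₀) with hB
  have hs1 : 0 < 1 - s₀ := by linarith [hs₀.2]
  have h1 : (B : EReal) ≤ hoeffding (detNonadaptive d) r ρ σ := by
    -- The threshold solves `(1 - s₀) * lam - φ(s₀) = r`, making the constraint tight.
    choose T hT hnull halt using hc.exists_thresholdTest M₀ ⟨hs₀.1, hs₀.2.le⟩
      ((r + logZ ρ σ s₀ M₀) / (1 - s₀))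
    refine le_trans (coe_le_liminf_rate (Eventually.of_forall fun n => ?_))
      (le_sSup ⟨T, hT, coe_le_liminf_rate (Eventually.of_forall fun n => ?_), rfl⟩)
    · refine (halt n).trans (le_of_eq ?_)
      congr 2
      rw [hB]
      field_simp
      ring
    · refine (hnull n).trans (le_of_eq ?_)
      congr 2
      field_simp
      ring
  have h2 : hoeffding (adaptive d) r ρ σ ≤ (B : EReal) := by
    refine sSup_le ?_
    rintro e ⟨T, -, hT, rfl⟩
    refine EReal.le_of_forall_lt_iff_le.1 fun z hz => liminf_rate_le_coe ?_
    obtain ⟨δ, hδ, hev⟩ := hc.exists_hoeffding_converse hr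
      (sub_pos.2 (EReal.coe_lt_coe_iff.1 hz)) hmax
    refine Eventually.frequently ?_
    filter_upwards [hev, eventually_le_exp_of_lt_liminf (sub_lt_self r hδ) hT] with n h1 h2
    have := h1 (T n) h2
    rwa [add_sub_cancel] at this
  have h3 := hoeffding_mono (ρ := ρ) (σ := σ) (Set.subset_univ (detNonadaptive d)) r
  have e1 : hoeffding (adaptive d) r ρ σ = (B : EReal) := le_antisymm h2 (h1.trans h3)
  refine ⟨⟨⟨M₀, ?_⟩, ?_⟩, le_antisymm h3 (e1.le.trans h1)⟩
  · simp only [hc.measuredPhi_eq, tilt_coe, e1]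
    exact le_antisymm (iSup₂_le fun s hs => EReal.coe_le_coe_iff.2 (hmax s hs M₀))
      (le_iSup₂_of_le s₀ hs₀ le_rfl)
  · rintro _ ⟨M, rfl⟩
    simp only [hc.measuredPhi_eq, tilt_coe, e1]
    exact iSup₂_le fun s hs => EReal.coe_le_coe_iff.2 (hmax s hs M)

end

section
variable {d : ℕ} {ρ σ : State d} {L : ℝ}

/-! ### The Han–Kobayashi bound -/

/-- Under the tilted law the likelihood ratio test typically accepts the null, at cost the averaged
`klNull` under `ρ`. If the averaged `klAlt` falls short of `r`, random damping of the acceptance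
supplies the deficit and costs the same rate under `ρ`. -/
theorem Comparable.hanKobayashi_twoPoint_le (hc : Comparable ρ σ L) (r s : ℝ) {t : ℝ}
    (ht0 : 0 ≤ t) (ht1 : t ≤ 1) (M M' : POVM d) :
    hanKobayashi (twoPointNonadaptive d) r ρ σ ≤
      ((t * klNull ρ σ s M + (1 - t) * klNull ρ σ s M' +
        max 0 (r - (t * klAlt ρ σ s M + (1 - t) * klAlt ρ σ s M')) : ℝ) : EReal) := by
  have := isProbabilityMeasure_twoPoint (d := d) ht1 M M'
  have hL := hc.1
  have hl := measurable_tiltLog ρ σ s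
  have hD : Measurable fun x => tiltLog ρ σ s x - llr ρ σ x := hl.sub (measurable_llr ρ σ)
  set S := Strategy.const (twoPoint t M M') with hS
  set F := t * klAlt ρ σ s M + (1 - t) * klAlt ρ σ s M' with hF
  set G := t * klNull ρ σ s M + (1 - t) * klNull ρ σ s M' with hG
  refine EReal.le_of_forall_lt_iff_le.1 fun z hz => ?_
  rw [EReal.coe_lt_coe_iff] at hz
  set ε := z - (G + max 0 (r - F)) with hε
  have hε0 : 0 < ε := sub_pos.2 hz
  set a := min r (F - ε / 3) with ha
  have haF : a < F := (min_le_right _ _).trans_lt (by linarith)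
  have hca : 0 ≤ r - a := sub_nonneg.2 (min_le_left _ _)
  have hca' : r - a ≤ max 0 (r - F) + ε / 3 := by
    rcases min_choice r (F - ε / 3) with h | h
    · rw [ha, h]
      linarith [le_max_left 0 (r - F)]
    · rw [ha, h]
      linarith [le_max_right 0 (r - F)]
  refine le_trans (sInf_le ⟨thresholdTest S hD a (r - a),
    fun n => const_twoPoint_mem_twoPointNonadaptive ht1 M M',
    coe_le_liminf_rate (Eventually.of_forall fun n => ?_), rfl⟩) ?_
  · rw [hc.acceptNull_eq]
    refine (lintegral_one_sub_thresholdTest S hD a n hca _ ρ).trans_le ?_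
    calc _ ≤ ENNReal.ofReal (Real.exp (-(n * (r - a)))) * ENNReal.ofReal (Real.exp (-(n * a))) := by
          gcongr
          exact hc.lintegral_sumGe_le S s a n
      _ = _ := by
          rw [← ENNReal.ofReal_mul (Real.exp_pos _).le, ← Real.exp_add]
          congr 2
          ring
  · obtain ⟨η, hη, htail⟩ := hc.exists_lintegral_compl_sumGe_le s ht0 ht1 M M' haF
    refine liminf_rate_le_coe (Eventually.frequently ?_)
    have hK : 0 < (2 * |s| + 1) * L := by positivity
    filter_upwards [eventually_exp_neg_mul_le hη one_half_pos,
      eventually_exp_le_lintegral (d := d) (ε := ε / 3) hK (by positivity) one_half_pos]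
      with n hn1 hn2
    set E := sumGe (fun x => tiltLog ρ σ s x - llr ρ σ x) a n with hE
    have hEm : MeasurableSet E := measurableSet_sumGe hD a n
    have hind : ∀ l : POVM d × ℕ → ℝ, ∀ h, E.indicator (fun _ => (1 : ℝ≥0∞)) h * weight l h =
        E.indicator (weight l) h := fun l h => by
      by_cases hh : h ∈ E <;> simp [hh]
    have hhalf : ENNReal.ofReal (1 / 2) ≤
        ∫⁻ h, E.indicator (fun _ => (1 : ℝ≥0∞)) h * weight (tiltLog ρ σ s) h ∂(S.law ρ n) := by
      simp only [hind]
      have hone := lintegral_weight_eq_one S ρ hl (hc.mean_exp_tiltLog s) n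
      have hsplit : ∫⁻ h, E.indicator (weight (tiltLog ρ σ s)) h ∂(S.law ρ n) +
          ∫⁻ h, Eᶜ.indicator (weight (tiltLog ρ σ s)) h ∂(S.law ρ n) = 1 := by
        rw [← hone, ← lintegral_add_left ((measurable_weight hl).indicator hEm)]
        refine lintegral_congr fun h => ?_
        exact Set.indicator_self_add_compl_apply E _ h
      by_contra hcon
      have h1 := (htail n).trans (ENNReal.ofReal_le_ofReal hn1)
      have := ENNReal.add_lt_add_of_lt_of_le (h1.trans_lt ENNReal.ofReal_lt_top).ne
        (not_le.1 hcon) h1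
      rw [hsplit, ← ENNReal.ofReal_add (by norm_num) (by norm_num)] at this
      norm_num at this
    have hstep : StepBound S ρ (tiltLog ρ σ s) (fun x => tiltLog ρ σ s x - 0)
        ((2 * |s| + 1) * L) G := by
      simp only [sub_zero]
      refine stepBound_twoPoint ρ ht0 ht1 M M' hl hl (hc.mean_exp_tiltLog s)
        (fun x => (hc.abs_tiltLog_le s x).trans ?_) (le_of_eq ?_)
      · gcongr
        linarith
      · rw [hc.mean_tiltLog, hc.mean_tiltLog]
    have key := hn2 S ρ _ _ G hl measurable_const hstep (E.indicator fun _ => 1)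
      (fun h => Set.indicator_apply_le' (fun _ => le_rfl) fun _ => zero_le) hhalf
    simp only [hind] at key
    rw [Test.acceptNull_eq]
    refine le_trans ?_ (lintegral_one_sub_thresholdTest S hD a n hca _ ρ).ge
    calc ENNReal.ofReal (Real.exp (-(n * z)))
        ≤ ENNReal.ofReal (Real.exp (-(n * (r - a)))) *
            ENNReal.ofReal (Real.exp (-(n * (G + ε / 3)))) := by
          rw [← ENNReal.ofReal_mul (Real.exp_pos _).le, ← Real.exp_add]
          refine ENNReal.ofReal_le_ofReal (Real.exp_le_exp.2 ?_)
          have : (n : ℝ) * (r - a + (G + ε / 3)) ≤ n * z := by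
            gcongr
            linarith
          linarith
      _ ≤ _ := by gcongr

/-- The parameters and POVMs that maximize `φ` and satisfy a closed condition form a set with closed
projection. -/
theorem Comparable.isClosed_setOf_exists_max (hc : Comparable ρ σ L) {Q : Set ℝ} (hQ : IsClosed Q) :
    IsClosed {s : ℝ | ∃ A : boundedPOVM d,
      (∀ B : boundedPOVM d, logZ ρ σ s (.ofFamily B) ≤ logZ ρ σ s (.ofFamily A)) ∧
      klAlt ρ σ s (.ofFamily A) ∈ Q} := by
  have h1 : IsClosed ((⋂ B : boundedPOVM d, {x : ℝ × boundedPOVM d |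
      logZ ρ σ x.1 (.ofFamily B) ≤ logZ ρ σ x.1 (.ofFamily x.2)}) ∩
      (fun x : ℝ × boundedPOVM d => klAlt ρ σ x.1 (.ofFamily x.2)) ⁻¹' Q) :=
    (isClosed_iInter fun B => isClosed_le ((hc.continuous_logZ _).comp continuous_fst)
      hc.continuous_logZ_ofFamily).inter (hQ.preimage hc.continuous_klAlt_ofFamily)
  convert isClosedMap_fst_of_compactSpace _ h1 using 1
  ext s
  simp

theorem Comparable.hanKobayashi_twoPoint_le_iSup (hc : Comparable ρ σ L) (r : ℝ) {V : ℝ → ℝ}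
    (hV : ∀ s, IsGreatest (Set.range (logZ ρ σ s)) (V s)) :
    hanKobayashi (twoPointNonadaptive d) r ρ σ ≤
      ⨆ s ∈ Set.Iic (0 : ℝ), (((-s * r - V s) / (1 - s) : ℝ) : EReal) := by
  have hterm : ∀ s ≤ (0 : ℝ), (((-s * r - V s) / (1 - s) : ℝ) : EReal) ≤
      ⨆ s ∈ Set.Iic (0 : ℝ), (((-s * r - V s) / (1 - s) : ℝ) : EReal) := fun s hs =>
    le_iSup₂_of_le s hs le_rfl
  have hV0 : V 0 = 0 := by
    obtain ⟨M, hM⟩ := (hV 0).1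
    rw [← hM, logZ_zero]
  have hVeq : ∀ {s : ℝ} {A : boundedPOVM d},
      (∀ B : boundedPOVM d, logZ ρ σ s (.ofFamily B) ≤ logZ ρ σ s (.ofFamily A)) →
      logZ ρ σ s (.ofFamily A) = V s := by
    intro s A hA
    refine le_antisymm ((hV s).2 ⟨_, rfl⟩) ?_
    obtain ⟨M, hM⟩ := (hV s).1
    obtain ⟨B, hB⟩ := hc.exists_logZ_le_ofFamily s M
    exact hM.ge.trans (hB.trans (hA B))
  -- Rates reachable without tilting: the exponent is `0`, the term at `s = 0`.
  by_cases h0 : ∃ M, r ≤ klAlt ρ σ 0 M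
  · obtain ⟨M, hM⟩ := h0
    refine (hc.hanKobayashi_twoPoint_le r 0 zero_le_one le_rfl M M).trans
      (le_trans (EReal.coe_le_coe_iff.2 (le_of_eq ?_)) (hterm 0 le_rfl))
    rw [max_eq_left (by linarith)]
    simp [klNull_zero, hV0]
  push Not at h0
  set U := {s : ℝ | ∃ A : boundedPOVM d,
      (∀ B : boundedPOVM d, logZ ρ σ s (.ofFamily B) ≤ logZ ρ σ s (.ofFamily A)) ∧
      klAlt ρ σ s (.ofFamily A) ∈ Set.Iic r} with hU
  set U' := {s : ℝ | ∃ A : boundedPOVM d,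
      (∀ B : boundedPOVM d, logZ ρ σ s (.ofFamily B) ≤ logZ ρ σ s (.ofFamily A)) ∧
      klAlt ρ σ s (.ofFamily A) ∈ Set.Ici r} with hU'
  have hUc : IsClosed U := hc.isClosed_setOf_exists_max isClosed_Iic
  have hUc' : IsClosed U' := hc.isClosed_setOf_exists_max isClosed_Ici
  have hcov : Set.Iic (0 : ℝ) ⊆ U ∪ U' := by
    intro s _
    obtain ⟨A, hA⟩ := hc.exists_max_logZ s
    rcases le_total (klAlt ρ σ s (.ofFamily A)) r with h | h
    · exact Or.inl ⟨A, fun B => hA _, h⟩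
    · exact Or.inr ⟨A, fun B => hA _, h⟩
  have hne : (Set.Iic (0 : ℝ) ∩ U).Nonempty := by
    obtain ⟨A, hA⟩ := hc.exists_max_logZ 0
    exact ⟨0, le_refl (0 : ℝ), A, fun B => hA _, (h0 _).le⟩
  by_cases hne' : (Set.Iic (0 : ℝ) ∩ U').Nonempty
  -- Two closed sets covering a connected half-line meet: at this `s` there are maximizers of `φ(s)`
  -- with `klAlt` on both sides of `r`.
  · obtain ⟨s, hs, ⟨A, hA, hAr⟩, ⟨B, hB, hBr⟩⟩ :=
      isPreconnected_closed_iff.1 isPreconnected_Iic U U' hUc hUc' hcov hne hne'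
    have hAr' : klAlt ρ σ s (.ofFamily A) ≤ r := hAr
    have hBr' : r ≤ klAlt ρ σ s (.ofFamily B) := hBr
    have hs' : s ≤ 0 := hs
    have hs1 : s ≠ 1 := by linarith
    obtain ⟨t, ht0, ht1, ht⟩ : ∃ t : ℝ, 0 ≤ t ∧ t ≤ 1 ∧
        t * klAlt ρ σ s (.ofFamily A) + (1 - t) * klAlt ρ σ s (.ofFamily B) = r := by
      rcases hAr'.eq_or_lt with h | h
      · exact ⟨1, zero_le_one, le_rfl, by simpa using h⟩
      · have hpos : 0 < klAlt ρ σ s (.ofFamily B) - klAlt ρ σ s (.ofFamily A) := by linarith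
        refine ⟨(klAlt ρ σ s (.ofFamily B) - r) /
          (klAlt ρ σ s (.ofFamily B) - klAlt ρ σ s (.ofFamily A)),
          div_nonneg (by linarith) hpos.le, (div_le_one hpos).2 (by linarith), ?_⟩
        field_simp
        ring
    refine (hc.hanKobayashi_twoPoint_le r s ht0 ht1 (.ofFamily A) (.ofFamily B)).trans
      (le_trans (EReal.coe_le_coe_iff.2 (le_of_eq ?_)) (hterm s hs'))
    -- Among maximizers at a fixed `s`, `klNull` is an affine function of `klAlt`, so the mixture
    -- has exactly the value of the formula at `r`.
    rw [ht, sub_self, max_self, add_zero, klNull_eq hs1, klNull_eq hs1, hVeq hA, hVeq hB, ← ht]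
    ring
  · refine EReal.le_of_forall_lt_iff_le.1 fun z hz => ?_
    obtain ⟨z', hz1, hz2⟩ := EReal.lt_iff_exists_real_btwn.1 hz
    have hε : 0 < z - z' := sub_pos.2 (EReal.coe_lt_coe_iff.1 hz2)
    have hL := hc.1
    -- No maximizer reaches `r`, so `s` is taken very negative. The damped test has exponent `r +
    -- R`, which differs from the term at `s` by at most `(|r| + L) / (1 - s)`, hence by less than
    -- `z - z'`.
    set s := -((|r| + L) / (z - z')) with hsdef
    have hneg : s < 0 := neg_lt_zero.2 (by positivity)
    obtain ⟨A, hA, hAr⟩ : s ∈ U := by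
      rcases hcov (show s ∈ Set.Iic (0 : ℝ) from hneg.le) with h | h
      · exact h
      · exact absurd ⟨s, hneg.le, h⟩ hne'
    have hAr' : klAlt ρ σ s (.ofFamily A) ≤ r := hAr
    refine (hc.hanKobayashi_twoPoint_le r s zero_le_one le_rfl (.ofFamily A) (.ofFamily A)).trans
      (EReal.coe_le_coe_iff.2 ?_)
    have hnn := hc.klNull_nonneg s (.ofFamily A)
    have hz3 := EReal.coe_le_coe_iff.1 ((hterm s hneg.le).trans hz1.le)
    have hVs := hVeq hA
    have hb := (abs_le.1 (hc.abs_logZ_le s (.ofFamily A))).1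
    rw [abs_of_neg hneg, hVs] at hb
    simp only [one_mul, sub_self, zero_mul, add_zero]
    rw [max_eq_right (by linarith)]
    have hεs : (1 - s) * (z - z') = (z - z') + (|r| + L) := by
      rw [hsdef]
      field_simp
      ring
    have hs1 : 0 < 1 - s := by linarith
    rw [div_le_iff₀ hs1] at hz3
    simp only [klNull, klAlt, hVs] at hnn ⊢
    set R := partZDeriv ρ σ s (.ofFamily A) / partZ ρ σ s (.ofFamily A) with hR
    -- Nonnegativity of `klNull` gives `-s * R ≤ -V s ≤ -s * L`.
    have hRL : R ≤ L := by
      have h1 : -s * R ≤ -s * L := by linarith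
      exact le_of_mul_le_mul_left h1 (neg_pos.2 hneg)
    have hrabs := le_abs_self r
    have : (1 - s) * (r + R) ≤ (1 - s) * z := by linarith
    have := le_of_mul_le_mul_left this hs1
    linarith

theorem hanKobayashi_anti {𝒞 𝒞' : Set (Strategy d)} (h : 𝒞 ⊆ 𝒞') (r : ℝ) :
    hanKobayashi 𝒞' r ρ σ ≤ hanKobayashi 𝒞 r ρ σ :=
  sInf_le_sInf fun _ ⟨T, h1, h2⟩ => ⟨T, fun n => h (h1 n), h2⟩

theorem Comparable.hanKobayashi_bound (hc : Comparable ρ σ L) (r : ℝ) :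
    hanKobayashi (adaptive d) r ρ σ =
        ⨆ s ∈ Set.Iic (0 : ℝ), tilt r s (⨆ M : POVM d, measuredPhi s ρ σ M) ∧
      hanKobayashi (twoPointNonadaptive d) r ρ σ = hanKobayashi (adaptive d) r ρ σ := by
  choose A hA using hc.exists_max_logZ
  have hsup : ∀ s, ⨆ M : POVM d, measuredPhi s ρ σ M = (logZ ρ σ s (.ofFamily (A s)) : EReal) := by
    intro s
    simp only [hc.measuredPhi_eq]
    exact le_antisymm (iSup_le fun M => EReal.coe_le_coe_iff.2 (hA s M))
      (le_iSup_of_le (.ofFamily (A s)) le_rfl)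
  simp only [hsup, tilt_coe]
  have h1 := hc.hanKobayashi_twoPoint_le_iSup r (V := fun s => logZ ρ σ s (.ofFamily (A s)))
    fun s => ⟨⟨_, rfl⟩, by rintro _ ⟨M, rfl⟩; exact hA s M⟩
  have h2 := hanKobayashi_anti (ρ := ρ) (σ := σ) (Set.subset_univ (twoPointNonadaptive d)) r
  have h3 : ⨆ s ∈ Set.Iic (0 : ℝ), (((-s * r - logZ ρ σ s (.ofFamily (A s))) / (1 - s) : ℝ) : EReal)
      ≤ hanKobayashi (adaptive d) r ρ σ := by
    refine iSup₂_le fun s hs => le_sInf ?_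
    rintro e ⟨T, -, hT, rfl⟩
    exact hc.tilt_le_liminf_rate T hs (hA s) hT
  exact ⟨le_antisymm (h2.trans h1) h3, le_antisymm (h1.trans h3) h2⟩

end

end OneWayLOCC

end

/-! ### Assembly of the four bounds -/

open OneWayLOCC in
theorem mainTheorem5 {d : ℕ} (ρ σ : State d) (hρ : ρ.mat.PosDef) (hσ : σ.mat.PosDef) :
    -- Stein bound
    (IsGreatest (Set.range (measuredKL ρ σ)) (stein (adaptive d) ρ σ) ∧
      steinStrong (adaptive d) ρ σ = stein (adaptive d) ρ σ ∧
      stein (detNonadaptive d) ρ σ = stein (adaptive d) ρ σ ∧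
      steinStrong (detNonadaptive d) ρ σ = stein (adaptive d) ρ σ) ∧
    -- Chernoff bound
    (∃ C : EReal,
      IsGreatest (Set.range fun M : POVM d => -⨅ s ∈ Set.Icc (0 : ℝ) 1, measuredPhi s ρ σ M) C ∧
      Tendsto (fun n => rate n (minErrorSum (adaptive d) ρ σ n)) atTop (𝓝 C) ∧
      Tendsto (fun n => rate n (minErrorSum (detNonadaptive d) ρ σ n)) atTop (𝓝 C)) ∧
    -- Hoeffding bound
    (∀ r : ℝ, 0 < r →
      IsGreatest
        (Set.range fun M : POVM d => ⨆ s ∈ Set.Ico (0 : ℝ) 1, tilt r s (measuredPhi s ρ σ M))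
        (hoeffding (adaptive d) r ρ σ) ∧
      hoeffding (detNonadaptive d) r ρ σ = hoeffding (adaptive d) r ρ σ) ∧
    -- Han–Kobayashi bound, with the maximum over the POVMs attained
    (∀ s : ℝ, s ≤ 0 → ∃ M : POVM d, IsGreatest (Set.range (measuredPhi s ρ σ)) (measuredPhi s ρ σ M)) ∧
    (∀ r : ℝ,
      hanKobayashi (adaptive d) r ρ σ =
        ⨆ s ∈ Set.Iic (0 : ℝ), tilt r s (⨆ M : POVM d, measuredPhi s ρ σ M) ∧
      hanKobayashi (twoPointNonadaptive d) r ρ σ = hanKobayashi (adaptive d) r ρ σ) := by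
  obtain ⟨L, hc⟩ := exists_comparable ρ σ hρ hσ
  refine ⟨hc.stein_bound, hc.chernoff_bound, fun r hr => hc.hoeffding_bound hr, fun s _ => ?_,
    hc.hanKobayashi_bound⟩
  obtain ⟨A, hA⟩ := hc.exists_max_logZ s
  refine ⟨.ofFamily A, ⟨_, rfl⟩, ?_⟩
  rintro _ ⟨M, rfl⟩
  rw [hc.measuredPhi_eq, hc.measuredPhi_eq, EReal.coe_le_coe_iff]
  exact hA M
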